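/- Let $\mathcal M=(E,\mathcal F)$ be a matroid with $|E|=m$ and rank $k\ge 1$, with parametric weights $w(e,\lambda)=a_e+\lambda b_e$, and let $1\le \ell\le m$. For $F\subseteq E$ let $\mathcal M_F$ be $\mathcal M$ with the elements of $F$ removed, let $B_\lambda^F$ be its minimum weight basis at $\lambda$ (ties broken by a fixed linear order of $E$), and let $y_F(\lambda)=w(B^F_\lambda,\lambda)$, with $y_F(\lambda)=\infty$ if $\mathcal M_F$ has rank less than $k$. Assume that $\mathcal M_F$ has rank $k$ for all $F$ with $|F|=\ell$. A set $F$ with $|F|=\ell$ is a set of $\ell$-most vital elements at $\lambda$ if it maximizes $y_F(\lambda)$ among the sets of $\ell$ elements. Call $F$ with $|F|=\ell$ relevant at $\lambda$ if it has a partition $F=F_1\,\dot\cup\dots\dot\cup\,F_t$ with $F_i=F\cap B_\lambda^{F_1\cup\dots\cup F_{i-1}}\neq\emptyset$ for all $i$. Fix $\lambda$ and consider the following algorithm. A node $s$ of level $i$ of a search tree stores a set $F(s)$ of $i$ elements, a set $f(s)$ of forbidden elements, the weight $w(T_0(s),\lambda)$, and bases $T_0(s),\dots,T_{\ell-i}(s)$,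 where $T_p(s)$ is the optimal basis of the matroid in which $F(s)$ and $T_0(s),\dots,T_{p-1}(s)$ are removed. Sort $E$ by weight and compute the bases $T_0,\dots,T_\ell$ of the root (with $F=f=\emptyset$) with $\ell+1$ runs of the greedy algorithm. For each node $s$ of level $i=0,\dots,\ell-2$, determine for all $e\in T_0(s)$ the replacement elements $r(e)$ (the lightest $r\in T_1(s)$ with $T_0(s)-e+r\in\mathcal F$), enumerate $T_0(s)\setminus f(s)=\{e_1,e_2,\dots\}$, and create for every $j$ a child $d$ with $F(d)=F(s)+e_j$, $f(d)=f(s)\cup\{e_1,\dots,e_{j-1}\}$, $T_0(d)=T_0(s)-e_j+r(e_j)$, and, successively for $p=1,\dots,\ell-i-1$, $T_p(d)=T_p(s)-g+g'$, where $g$ is the element that moved from $T_p(s)$ to $T_{p-1}(d)$ and $g'$ is the lightest element of $T_{p+1}(s)$ with $T_p(s)-g+g'\in\mathcal F$, found by testing all elements of $T_{p+1}(s)$ (if no element moved, $T_p(d)=T_p(s)$; if there is no $g'$, $T_p(d)=T_p(s)-g$ and no element moves further). Finally, for each node $s$ of level $\ell-1$ and each $e\in T_0(s)$, output $F=F(s)+e$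 with the value $w(T_0(s),\lambda)-w(e,\lambda)+w(r(e),\lambda)$. Count one step for each elementary operation, $f(m)\ge 1$ steps for an independence test, and $H(m)$ steps for computing the replacement elements of all elements of a given basis. Then: 1. The output consists of exactly $k\binom{k+\ell-2}{\ell-1}$ candidates, counted with repetitions (one for each pair $(s,e)$); each candidate $F$ has $\ell$ elements and is output with its correct value $y_F(\lambda)$. 2. The sets $F$ in the output are exactly the relevant sets at $\lambda$. At least one of them is a set of $\ell$-most vital elements at $\lambda$; if for every $G$ with $|G|<\ell$ the minimum weight basis of $\mathcal M_G$ at $\lambda$ is unique (without tie-breaking), then every set of $\ell$-most vital elements at $\lambda$ is in the output. If $J\ni\lambda$ is an interval on which the weights are pairwise distinct at every point, then every $F\subseteq E$ with $|F|=\ell$ is dominated on $J$ by some set $F'$ in the output, i.e. $y_{F'}(\mu)\ge y_F(\mu)$ for all $\mu\in J$. 3. The running time is $$O\Big((k+\ell)^{\ell-1}\big(H(m)+k\ell f(m)\big)+m\big(\log m+\ell f(m)\big)\Big),$$ with an absolute constant (in particular, independent of $\ell$). -/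

import Mathlib

namespace MatroidInterdiction

/-! ### Parametric matroids and interdiction -/

section Interdiction

variable {E : Type} [LinearOrder E]

/-- The parametric weight `w(e, lam) = a_e + lam * b_e`. -/
def weight (a b : E → ℝ) (lam : ℝ) (e : E) : ℝ := a e + lam * b e

/-- The rank `k` of the matroid. -/
noncomputable def rk (M : Matroid E) : ℕ := M.eRank.toNat

/-- `B` is a minimum weight basis of `M_F`, the matroid `M` with the elements of `F` removed. -/
def IsMinWeightBasis (M : Matroid E) (w : E → ℝ) (F B : Finset E) : Prop :=
  (M.delete (F : Set E)).IsBase (B : Set E) ∧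
    ∀ B' : Finset E, (M.delete (F : Set E)).IsBase (B' : Set E) → ∑ e ∈ B, w e ≤ ∑ e ∈ B', w e

/-- `B` is *the* optimal basis `B^F` of `M_F`: it has minimum weight, and ties are broken by the
fixed order of the elements (among the minimum weight bases, `B` is the least one in the
colexicographic order). If the minimum weight basis is unique, then it is `B^F`. -/
def IsOptBasis (M : Matroid E) (w : E → ℝ) (F B : Finset E) : Prop :=
  IsMinWeightBasis M w F B ∧
    ∀ B' : Finset E, IsMinWeightBasis M w F B' → toColex B ≤ toColex B'

/-- The value `y_F`: the weight of a minimum weight basis of `M_F`, and `⊤` (that is, `∞`) if `M_F`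
has no basis of cardinality `rk M`. -/
noncomputable def y (M : Matroid E) (w : E → ℝ) (F : Finset E) : EReal :=
  ⨅ B ∈ {B : Finset E | (M.delete (F : Set E)).IsBase (B : Set E) ∧ B.card = rk M},
    ((∑ e ∈ B, w e : ℝ) : EReal)

/-- `F` is a set of `ℓ`-most vital elements. -/
def IsMostVital (M : Matroid E) (w : E → ℝ) (ℓ : ℕ) (F : Finset E) : Prop :=
  F.card = ℓ ∧ ∀ G : Finset E, G.card = ℓ → y M w G ≤ y M w F

/-- `Chain M w F A` says that `A = F_1 ∪ … ∪ F_t` for some `t ≥ 0`, where each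
`F_i = F ∩ B^(F_1 ∪ … ∪ F_(i-1))` is non-empty (so that the `F_i` are pairwise disjoint). -/
inductive Chain (M : Matroid E) (w : E → ℝ) (F : Finset E) : Finset E → Prop
  | empty : Chain M w F ∅
  | step {A B : Finset E} : Chain M w F A → IsOptBasis M w A B → (F ∩ B).Nonempty →
      Chain M w F (A ∪ (F ∩ B))

/-- The relevant candidates for a set of `ℓ`-most vital elements: the sets `F` of `ℓ` elements with a
partition `F = F_1 ∪ … ∪ F_t` such that `F_i = F ∩ B^(F_1 ∪ … ∪ F_(i-1))` is non-empty for
all `i`. -/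
def IsRelevant (M : Matroid E) (w : E → ℝ) (ℓ : ℕ) (F : Finset E) : Prop :=
  F.card = ℓ ∧ Chain M w F F

/-- Elements are compared by weight, ties being broken by the fixed order of the elements. -/
noncomputable def key (w : E → ℝ) (e : E) : ℝ ×ₗ E := toLex (w e, e)

/-- `r` is the replacement element of `e` with respect to the basis `B`, in the matroid `M`
restricted to `B ∪ S`: the least element `r` of `S \ B` such that `B - e + r` is independent. -/
def IsReplacement (M : Matroid E) (w : E → ℝ) (B S : List E) (e r : E) : Prop :=
  (r ∈ S ∧ r ∉ B ∧ M.Indep (insert r ({x | x ∈ B} \ {e}))) ∧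
    ∀ r' : E, r' ∈ S → r' ∉ B → M.Indep (insert r' ({x | x ∈ B} \ {e})) → key w r ≤ key w r'

end Interdiction

/-! ### Step counting

A value of type `Timed α` is the result of a computation together with the number of steps that the
computation takes. Sets are stored as lists without repetition. Every call, and so every recursive
call, of a procedure costs one step. The body of a procedure performs, besides calls, only a bounded
number of operations of unit cost: inspecting or building a list cell, a pair, an option or a
record, comparing two elements or two weights, evaluating the weight of an element, an addition or
a subtraction of weights. The two matroid operations cost as much as is prescribed: `f` steps for an
independence test and `H` steps for the computation of all replacement elements for a basis. -/

/-- The result of a computation and the number of its steps. -/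
structure Timed (α : Type) where
  val : α
  time : ℕ

instance : Monad Timed where
  pure x := ⟨x, 0⟩
  bind p q := ⟨(q p.val).val, p.time + (q p.val).time⟩

/-- One step. -/
def tick : Timed Unit := ⟨(), 1⟩

section Algorithm

variable {E : Type} [LinearOrder E]

/-! #### Matroid operations -/

/-- Independence test, at the price of `f` steps. -/
noncomputable def indepTest (M : Matroid E) (f : ℕ) (l : List E) : Timed Bool :=
  ⟨@decide (M.Indep {x | x ∈ l}) (Classical.propDecidable _), f⟩

open Classical in
/-- The replacement element of `e`, if there is one. -/
noncomputable def replacement (M : Matroid E) (w : E → ℝ) (B S : List E) (e : E) : Option E :=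
  if h : ∃ r, IsReplacement M w B S e r then some h.choose else none

/-- The pairs `(e, r(e))` of the elements `e` of the basis `B` and their replacement elements `r(e)` in
`S`, in the order of the list `B`, at the price of `H` steps altogether. (An element without a
replacement element is left out.) -/
noncomputable def replacements (M : Matroid E) (w : E → ℝ) (H : ℕ) (B S : List E) :
    Timed (List (E × E)) :=
  ⟨B.filterMap fun e => (replacement M w B S e).map fun r => (e, r), H⟩

/-! #### Sorting (bottom-up merge sort) -/

/-- Merge two sorted lists. -/
noncomputable def merge (w : E → ℝ) : List E → List E → Timed (List E)
  | [], ys => do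
    tick
    return ys
  | x :: xs, [] => do
    tick
    return x :: xs
  | x :: xs, z :: zs => do
    tick
    if key w x ≤ key w z then
      let l ← merge w xs (z :: zs)
      return x :: l
    else
      let l ← merge w (x :: xs) zs
      return z :: l
termination_by xs ys => xs.length + ys.length

/-- Merge the first list with the second one, the third one with the fourth one, and so on. -/
noncomputable def mergePairs (w : E → ℝ) : List (List E) → Timed (List (List E))
  | [] => do
    tick
    return []
  | [l] => do
    tick
    return [l]
  | l₁ :: l₂ :: ls => do
    tick
    let l ← merge w l₁ l₂
    let ls' ← mergePairs w ls
    return l :: ls'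

/-- Merge pairs repeatedly, at most `n` times, until at most one list is left. -/
noncomputable def mergeAll (w : E → ℝ) : ℕ → List (List E) → Timed (List E)
  | _, [] => do
    tick
    return []
  | _, [l] => do
    tick
    return l
  | 0, l :: _ => do
    tick
    return l
  | n + 1, l₁ :: l₂ :: ls => do
    tick
    let ls' ← mergePairs w (l₁ :: l₂ :: ls)
    mergeAll w n ls'

/-- The list of the one-element lists. -/
def singletons : List E → Timed (List (List E))
  | [] => do
    tick
    return []
  | x :: xs => do
    tick
    let ls ← singletons xs
    return [x] :: ls

/-- The length of a list. -/
def length : List (List E) → Timed ℕ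
  | [] => do
    tick
    return 0
  | _ :: ls => do
    tick
    let n ← length ls
    return n + 1

/-- Sort the elements by weight (`length` rounds of merging are more than enough). -/
noncomputable def sort (w : E → ℝ) (es : List E) : Timed (List E) := do
  tick
  let ls ← singletons es
  let n ← length ls
  mergeAll w n ls

/-! #### Operations on lists -/

/-- Concatenation. -/
def append {α : Type} : List α → List α → Timed (List α)
  | [], ys => do
    tick
    return ys
  | x :: xs, ys => do
    tick
    let l ← append xs ys
    return x :: l

/-- Membership. -/
def member (e : E) : List E → Timed Bool
  | [] => do
    tick
    return false
  | x :: xs => do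
    tick
    if x = e then return true else member e xs

/-- Delete the element `e`. -/
def erase (e : E) : List E → Timed (List E)
  | [] => do
    tick
    return []
  | x :: xs => do
    tick
    if x = e then return xs
    else
      let l ← erase e xs
      return x :: l

/-- The total weight. -/
noncomputable def totalWeight (w : E → ℝ) : List E → Timed ℝ
  | [] => do
    tick
    return 0
  | x :: xs => do
    tick
    let v ← totalWeight w xs
    return w x + v

/-! #### The set `U^ℓ` -/

/-- The greedy algorithm on a sorted list. The elements accepted so far are in the second list. The
result consists of the elements that are accepted from now on, and of the rejected ones. -/
noncomputable def greedy (M : Matroid E) (f : ℕ) : List E → List E → Timed (List E × List E)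
  | [], _ => do
    tick
    return ([], [])
  | x :: xs, cur => do
    tick
    if ← indepTest M f (x :: cur) then
      let (B, R) ← greedy M f xs (x :: cur)
      return (x :: B, R)
    else
      let (B, R) ← greedy M f xs cur
      return (B, x :: R)

/-- Compute `n` bases one after the other with the greedy algorithm, each in the matroid in which the
previous ones are deleted. -/
noncomputable def bases (M : Matroid E) (f : ℕ) : ℕ → List E → Timed (List (List E))
  | 0, _ => do
    tick
    return []
  | n + 1, xs => do
    tick
    let (B, R) ← greedy M f xs []
    let Ts ← bases M f n R
    return B :: Ts

/-! #### The search tree -/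

/-- A node `s` of the search tree, of level `i`: the set `F(s)` of interdicted elements, the set `f(s)` of
elements that must not be deleted, the weight `w(T_0(s))`, the basis `T_0(s)`, and the list
`T_1(s), …, T_(ℓ-i)(s)` of the further bases. -/
structure Node (E : Type) where
  F : List E
  forb : List E
  wT0 : ℝ
  T0 : List E
  Ts : List (List E)

/-- The root of the search tree. -/
noncomputable def root (M : Matroid E) (w : E → ℝ) (f ℓ : ℕ) (es : List E) : Timed (Node E) := do
  tick
  let l ← sort w es
  let (T0, R) ← greedy M f l []
  let Ts ← bases M f ℓ R
  let v ← totalWeight w T0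
  return ⟨[], [], v, T0, Ts⟩

/-- The least element `x` of a list such that `S + x` is independent, given the least one (`best`) among
the elements inspected before. -/
noncomputable def search (M : Matroid E) (w : E → ℝ) (f : ℕ) (S : List E) :
    List E → Option E → Timed (Option E)
  | [], best => do
    tick
    return best
  | x :: xs, best => do
    tick
    if ← indepTest M f (x :: S) then
      match best with
      | none => search M w f S xs (some x)
      | some z => if key w x < key w z then search M w f S xs (some x)
                  else search M w f S xs (some z)
    else search M w f S xs best

/-- Given `T_j(s), T_(j+1)(s), …`, compute `T_j(d), T_(j+1)(d), …` for a child `d` of `s`. The element `g`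
that has moved from `T_j(s)` to the previous basis is deleted from `T_j(s)` and replaced by its
replacement element, which is looked for in `T_(j+1)(s)` and is then treated in the same way. If no
element moves (because there was no replacement element), then the bases remain as they are. The
last basis of `s` is not needed any more. -/
noncomputable def shift (M : Matroid E) (w : E → ℝ) (f : ℕ) :
    Option E → List (List E) → Timed (List (List E))
  | _, [] => do
    tick
    return []
  | _, [_] => do
    tick
    return []
  | none, T :: T' :: Ts => do
    tick
    let Ts' ← shift M w f none (T' :: Ts)
    return T :: Ts'
  | some g, T :: T' :: Ts => do
    tick
    let S ← erase g T
    match ← search M w f S T' none with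
    | none =>
      let Ts' ← shift M w f none (T' :: Ts)
      return S :: Ts'
    | some x =>
      let Ts' ← shift M w f (some x) (T' :: Ts)
      return (x :: S) :: Ts'

/-- The child of `s` that is obtained by interdicting `e`, with replacement element `r`. -/
noncomputable def child (M : Matroid E) (w : E → ℝ) (f : ℕ) (s : Node E) (forb : List E) (e r : E) :
    Timed (Node E) := do
  tick
  let S ← erase e s.T0
  let Ts' ← shift M w f (some r) s.Ts
  return ⟨e :: s.F, forb, s.wT0 - w e + w r, r :: S, Ts'⟩

/-- Go through the pairs `(e, r(e))` with `e` in `T_0(s)`. Each `e` that is not in `f(s)` yields a child and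
is forbidden for the later children. -/
noncomputable def childrenLoop (M : Matroid E) (w : E → ℝ) (f : ℕ) (s : Node E) :
    List (E × E) → List E → Timed (List (Node E))
  | [], _ => do
    tick
    return []
  | (e, r) :: ps, forb => do
    tick
    if ← member e forb then childrenLoop M w f s ps forb
    else
      let d ← child M w f s forb e r
      let ds ← childrenLoop M w f s ps (e :: forb)
      return d :: ds

/-- The children of `s`. -/
noncomputable def children (M : Matroid E) (w : E → ℝ) (f H : ℕ) (s : Node E) :
    Timed (List (Node E)) := do
  tick
  let ps ← replacements M w H s.T0 (s.Ts.headD [])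
  childrenLoop M w f s ps s.forb

/-- From the nodes of one level to the nodes of the next level. -/
noncomputable def nextLevel (M : Matroid E) (w : E → ℝ) (f H : ℕ) :
    List (Node E) → Timed (List (Node E))
  | [] => do
    tick
    return []
  | s :: ss => do
    tick
    let ds ← children M w f H s
    let rest ← nextLevel M w f H ss
    append ds rest

/-- Go down `n` levels. -/
noncomputable def levels (M : Matroid E) (w : E → ℝ) (f H : ℕ) :
    ℕ → List (Node E) → Timed (List (Node E))
  | 0, N => do
    tick
    return N
  | n + 1, N => do
    tick
    let N' ← nextLevel M w f H N
    levels M w f H n N'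

/-- The candidates `F(s) + e` with their values, for the elements `e` of `T_0(s)`. -/
noncomputable def outputLoop (w : E → ℝ) (s : Node E) :
    List (E × E) → Timed (List (List E × ℝ))
  | [] => do
    tick
    return []
  | (e, r) :: ps => do
    tick
    let out ← outputLoop w s ps
    return (e :: s.F, s.wT0 - w e + w r) :: out

/-- The candidates with their values for all nodes of the last level. -/
noncomputable def output (M : Matroid E) (w : E → ℝ) (H : ℕ) :
    List (Node E) → Timed (List (List E × ℝ))
  | [] => do
    tick
    return []
  | s :: ss => do
    tick
    let ps ← replacements M w H s.T0 (s.Ts.headD [])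
    let out ← outputLoop w s ps
    let rest ← output M w H ss
    append out rest

/-- The whole algorithm, for the matroid `M` with weights `w`, on the list `es` of all elements: it
returns the list of the candidates `F` together with the values `y_F`. -/
noncomputable def computeCandidates (M : Matroid E) (w : E → ℝ) (ℓ f H : ℕ) (es : List E) :
    Timed (List (List E × ℝ)) := do
  tick
  let a ← root M w f ℓ es
  let N ← levels M w f H (ℓ - 1) [a]
  output M w H N

end Algorithm

/-- The collection of the sets `F` that occur in an output of the algorithm. -/
def candidates {E : Type} [LinearOrder E] (out : List (List E × ℝ)) : Set (Finset E) :=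
  {F | ∃ p ∈ out, p.1.toFinset = F}

end MatroidInterdiction

open MatroidInterdiction

/-! With ties broken by `key`, the optimal basis of M_A has a closed form, `opt`: an element outside
A belongs to it iff it is not spanned by the smaller elements outside A. Hence deleting further
elements never expels a surviving element from the basis (`mem_opt_of_subset`). Almost everything
rests on this monotonicity.

Relevance: for a set of ℓ elements, having the required partition is equivalent to being
exhaustible, that is, F meets `opt M w A` for every proper subset A of F (`isRelevant_iff`). Adding
an element of the current optimal basis keeps a set exhaustible, so every set in the tree is
exhaustible. Conversely, an exhaustible G always meets the basis of a node with F(s) ⊂ G. The first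
element of G in that basis leads to a child whose forbidden elements avoid G, so G is reached.

Domination: if F is not exhaustible, some exhaustible A ⊂ F satisfies F ∩ `opt M w A` = ∅, so M_A
and M_F have the same optimal basis. Extending A to an exhaustible F' of ℓ elements can only raise
the value (`exists_isExhaustible_dominating`). If the minimum weight bases are unique, the first
added element raises it strictly, so no most vital set is missed. On an interval without equal
weights the order of the elements is constant, so the same F' works throughout.

Stored data: interdicting a basis element lets at most one element move up from each layer to the
preceding one (`opt_insert_of_indep`, `Layers.shift_some`).

Counting: a node with j forbidden elements has `(k - j).multichoose n` descendants n levels below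
(`sum_multichoose_childrenLoop`). The node counts of all levels add up to a single multichoose
number, bounded by a power of k + ℓ (`sum_range_multichoose`), so no extra factor ℓ arises from the
number of levels. -/

namespace MatroidInterdiction

/-! ### The optimal basis and its change under one deletion. -/

section OptimalBasis

variable {E : Type} [Fintype E] [LinearOrder E] {M : Matroid E} {w : E → ℝ}

omit [Fintype E] [LinearOrder E] in
lemma key_injective (w : E → ℝ) : Function.Injective (key w) := fun x z h => by
  simpa [key] using congrArg (fun p => (ofLex p).2) h

open Classical in
/-- The elements of the optimal basis of `M_A`: those that are not spanned by the elements of smaller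
key outside `A`. -/
noncomputable def opt (M : Matroid E) (w : E → ℝ) (A : Finset E) : Finset E :=
  {x | x ∉ A ∧ x ∉ M.closure {z | z ∉ A ∧ key w z < key w x}}

lemma mem_opt {A : Finset E} {x : E} :
    x ∈ opt M w A ↔ x ∉ A ∧ x ∉ M.closure {z | z ∉ A ∧ key w z < key w x} := by
  simp [opt]

/-- Deleting more leaves fewer smaller elements, and these span less. -/
lemma mem_opt_of_subset {A A' : Finset E} (h : A ⊆ A') {x : E} (hx : x ∈ opt M w A) (hx' : x ∉ A') :
    x ∈ opt M w A' :=
  mem_opt.2 ⟨hx', fun hc => (mem_opt.1 hx).2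
    (M.closure_subset_closure (by rintro z ⟨h1, h2⟩; exact ⟨fun hA => h1 (h hA), h2⟩) hc)⟩

/-- Induction on the number of smaller elements: a rejected element is spanned by smaller ones, each
of which is already spanned by smaller elements of `opt`. -/
lemma mem_closure_opt (hE : M.E = Set.univ) {A : Finset E} {x : E} (hx : x ∉ A) :
    x ∈ M.closure {z | z ∈ opt M w A ∧ key w z ≤ key w x} := by
  obtain ⟨n, hn⟩ : ∃ n, n = (Finset.univ.filter fun z => key w z < key w x).card := ⟨_, rfl⟩
  induction n using Nat.strong_induction_on generalizing x with
  | _ n ih =>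
    by_cases ho : x ∈ opt M w A
    · exact M.mem_closure_of_mem' ⟨ho, le_rfl⟩ (by simp [hE])
    · have hc : x ∈ M.closure {z | z ∉ A ∧ key w z < key w x} := by
        by_contra hc
        exact ho (mem_opt.2 ⟨hx, hc⟩)
      refine M.closure_subset_closure_of_subset_closure (fun z hz => ?_) hc
      refine M.closure_subset_closure (by rintro u ⟨h1, h2⟩; exact ⟨h1, h2.trans hz.2.le⟩)
        (ih _ ?_ hz.1 rfl)
      rw [hn]
      refine Finset.card_lt_card (Finset.ssubset_iff_of_subset ?_ |>.2 ⟨z, ?_, ?_⟩)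
      · intro u hu
        simp only [Finset.mem_filter, Finset.mem_univ, true_and] at hu ⊢
        exact hu.trans hz.2
      · simpa using hz.2
      · simp

lemma mem_closure_opt_of_notMem (hE : M.E = Set.univ) {A : Finset E} {x : E} (hx : x ∉ A)
    (ho : x ∉ opt M w A) : x ∈ M.closure {z | z ∈ opt M w A ∧ key w z < key w x} := by
  refine M.closure_subset_closure ?_ (mem_closure_opt (w := w) hE hx)
  rintro z ⟨h1, h2⟩
  exact ⟨h1, lt_of_le_of_ne h2 fun h => ho (key_injective w h ▸ h1)⟩

/-- The largest element of a circuit inside `opt` would be spanned by the others, which are smaller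
and outside A. -/
lemma opt_indep (hE : M.E = Set.univ) (A : Finset E) : M.Indep (opt M w A : Set E) := by
  rw [Matroid.indep_iff_forall_subset_not_isCircuit (by simp [hE])]
  intro C hC hcirc
  obtain ⟨x, hx, hmax⟩ := Set.exists_max_image C (key w) C.toFinite hcirc.nonempty
  refine (mem_opt.1 (hC hx)).2 (M.closure_subset_closure ?_ (hcirc.mem_closure_sdiff_singleton_of_mem hx))
  exact fun z hz => ⟨(mem_opt.1 (hC hz.1)).1,
    lt_of_le_of_ne (hmax z hz.1) fun h => hz.2 (key_injective w h)⟩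

lemma opt_isBasis (hE : M.E = Set.univ) (A : Finset E) :
    M.IsBasis (opt M w A : Set E) (M.E \ A) :=
  (opt_indep hE A).isBasis_of_subset_of_subset_closure
    (fun _ hx => ⟨by simp [hE], (mem_opt.1 hx).1⟩)
    (fun _ hx => M.closure_subset_closure (fun _ hz => hz.1) (mem_closure_opt hE hx.2))

lemma opt_isBase (hE : M.E = Set.univ) (A : Finset E) :
    (M.delete (A : Set E)).IsBase (opt M w A : Set E) :=
  Matroid.delete_isBase_iff.2 (opt_isBasis hE A)

/-- The optimal basis admits no improving exchange. -/
lemma key_lt_of_exchange (hE : M.E = Set.univ) {A : Finset E} {x z : E}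
    (hz : z ∉ A) (hz' : z ∉ opt M w A) (hi : M.Indep (insert z (opt M w A \ {x} : Set E))) :
    key w x < key w z := by
  by_contra! hlt
  have hm := (hi.subset (Set.subset_insert _ _)).insert_indep_iff_of_notMem (e := z)
    (by simp [hz'])
  refine (hm.1 hi).2 (M.closure_subset_closure ?_ (mem_closure_opt_of_notMem hE hz hz'))
  rintro u ⟨hu, hlu⟩
  refine ⟨hu, ?_⟩
  rintro rfl
  exact absurd hlu hlt.not_gt

/-- The exchange brings in the least element of the symmetric difference, which must lie in `opt`,
and removes an element of its fundamental circuit. -/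
lemma exists_improving_exchange (hE : M.E = Set.univ) {A B : Finset E}
    (hB : (M.delete (A : Set E)).IsBase (B : Set E)) (hne : B ≠ opt M w A) :
    ∃ x ∈ opt M w A, x ∉ B ∧ ∃ z ∈ B, z ∉ opt M w A ∧ key w x < key w z ∧
      (M.delete (A : Set E)).IsBase (insert x (B.erase z) : Finset E) := by
  have hBA : ∀ z ∈ B, z ∉ A := fun z hz => (hB.subset_ground hz).2
  have hBi : M.Indep (B : Set E) := (Matroid.delete_indep_iff.1 hB.indep).1
  have hd : (symmDiff B (opt M w A)).Nonempty := by
    rw [Finset.nonempty_iff_ne_empty]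
    exact fun h => hne (symmDiff_eq_bot.1 h)
  obtain ⟨x, hx, hmin⟩ := Finset.exists_min_image _ (key w) hd
  have hx1 : x ∈ opt M w A ∧ x ∉ B := by
    rcases Finset.mem_symmDiff.1 hx with ⟨h1, h2⟩ | h
    -- By minimality, all elements of `opt` below x lie in B. They span x, so B would be dependent.
    · exfalso
      refine hBi.notMem_closure_sdiff_of_mem h1 (M.closure_subset_closure ?_
        (mem_closure_opt_of_notMem hE (hBA x h1) h2))
      rintro u ⟨hu, hlu⟩
      have huB : u ∈ B := by
        by_contra hn
        exact (hmin u (Finset.mem_symmDiff.2 (Or.inr ⟨hu, hn⟩))).not_gt hlu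
      exact ⟨huB, by rintro rfl; exact lt_irrefl _ hlu⟩
    · exact h
  have hxE : x ∈ (M.delete (A : Set E)).E := ⟨by simp [hE], (mem_opt.1 hx1.1).1⟩
  have hC := hB.fundCircuit_isCircuit hxE hx1.2
  obtain ⟨z, hzC, hzO⟩ : ∃ z ∈ (M.delete (A : Set E)).fundCircuit x B, z ∉ opt M w A := by
    by_contra! hcon
    exact hC.dep.not_indep ((opt_isBase hE A).indep.subset hcon)
  have hzx : z ≠ x := by rintro rfl; exact hzO hx1.1
  have hzB : z ∈ B := by
    rcases Matroid.fundCircuit_subset_insert _ _ _ hzC with h | h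
    · exact absurd h hzx
    · exact h
  have hi := (hB.indep.mem_fundCircuit_iff (by rw [hB.closure_eq]; exact hxE) hx1.2).1 hzC
  refine ⟨x, hx1.1, hx1.2, z, hzB, hzO, ?_, ?_⟩
  · refine lt_of_le_of_ne (hmin z (Finset.mem_symmDiff.2 (Or.inl ⟨hzB, hzO⟩))) fun h => ?_
    exact hzx (key_injective w h).symm
  · have := hB.exchange_isBase_of_indep' hzB hx1.2 hi
    convert this using 1
    ext u
    simp only [Finset.coe_insert, Finset.coe_erase, Set.mem_insert_iff, Set.mem_sdiff,
      Set.mem_singleton_iff]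
    grind

omit [Fintype E] in
lemma key_lt_iff {x z : E} : key w x < key w z ↔ w x < w z ∨ w x = w z ∧ x < z := by
  simp [key, Prod.Lex.toLex_lt_toLex]

/-- Improving exchanges lead from B to `opt` without increasing the weight. If B is itself of
minimum weight, every exchange is a tie in weight, so it inserts an element earlier in the fixed
order and lowers the basis colexicographically. -/
lemma opt_optimal (hE : M.E = Set.univ) {A B : Finset E}
    (hB : (M.delete (A : Set E)).IsBase (B : Set E)) :
    ∑ e ∈ opt M w A, w e ≤ ∑ e ∈ B, w e ∧
      (∑ e ∈ B, w e ≤ ∑ e ∈ opt M w A, w e → toColex (opt M w A) ≤ toColex B) := by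
  obtain ⟨n, hn⟩ : ∃ n, n = (B \ opt M w A).card := ⟨_, rfl⟩
  induction n using Nat.strong_induction_on generalizing B with
  | _ n ih =>
    by_cases hne : B = opt M w A
    · exact ⟨hne ▸ le_rfl, fun _ => hne ▸ le_rfl⟩
    obtain ⟨x, hxO, hxB, z, hzB, hzO, hlt, hB'⟩ := exists_improving_exchange hE hB hne
    have hxz : x ∉ B.erase z := fun h => hxB (Finset.mem_of_mem_erase h)
    obtain ⟨h1, h2⟩ := ih _ (by
      rw [hn]
      refine Finset.card_lt_card (Finset.ssubset_iff_of_subset ?_ |>.2 ⟨z, ?_, ?_⟩)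
      · intro u; simp only [Finset.mem_sdiff, Finset.mem_insert, Finset.mem_erase]; grind
      · simp [hzB, hzO]
      · simp only [Finset.mem_sdiff, Finset.mem_insert, Finset.mem_erase]; grind) hB' rfl
    have hs : ∑ e ∈ insert x (B.erase z), w e + w z = w x + ∑ e ∈ B, w e := by
      rw [Finset.sum_insert hxz, add_assoc, Finset.sum_erase_add _ _ hzB]
    have hwz : w x ≤ w z := by
      rcases key_lt_iff.1 hlt with h | h
      · exact h.le
      · exact h.1.le
    refine ⟨by linarith, fun hle => ?_⟩
    have hxzE : x < z := by
      rcases key_lt_iff.1 hlt with h | h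
      · linarith
      · exact h.2
    refine (h2 (by linarith)).trans (le_of_lt ?_)
    rw [← Finset.insert_erase hzB, Finset.erase_insert (Finset.notMem_erase _ _)]
    exact (Finset.Colex.insert_lt_insert hxz (Finset.notMem_erase _ _)).2 hxzE

lemma opt_isMinWeightBasis (hE : M.E = Set.univ) (A : Finset E) :
    IsMinWeightBasis M w A (opt M w A) :=
  ⟨opt_isBase hE A, fun _ hB => (opt_optimal hE hB).1⟩

lemma isOptBasis_iff (hE : M.E = Set.univ) {A B : Finset E} :
    IsOptBasis M w A B ↔ B = opt M w A := by
  have ho : IsOptBasis M w A (opt M w A) :=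
    ⟨opt_isMinWeightBasis hE A, fun B hB => (opt_optimal hE hB.1).2 (hB.2 _ (opt_isBase hE A))⟩
  refine ⟨fun h => ?_, fun h => h ▸ ho⟩
  exact toColex_inj.1 (le_antisymm (h.2 _ ho.1) (ho.2 _ h.1))

omit [Fintype E] [LinearOrder E] in
lemma card_le_of_indep {k : ℕ} (hr : M.eRank = k) {B : Finset E} (hB : M.Indep (B : Set E)) :
    B.card ≤ k := by
  have := hB.encard_le_eRank
  rw [hr, Set.encard_coe_eq_coe_finsetCard] at this
  exact_mod_cast this

omit [LinearOrder E] in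
lemma eRank_eq_rk (M : Matroid E) : M.eRank = rk M := by
  obtain ⟨B, hB⟩ := M.exists_isBase
  rw [rk, ← hB.encard_eq_eRank, ENat.natCast_toNat B.toFinite.encard_lt_top.ne]

lemma card_opt_le (hE : M.E = Set.univ) (A : Finset E) : (opt M w A).card ≤ rk M :=
  card_le_of_indep (eRank_eq_rk M) (opt_indep hE A)

lemma card_eq_of_isBase (hE : M.E = Set.univ) {A B : Finset E}
    (hB : (M.delete (A : Set E)).IsBase (B : Set E)) : B.card = (opt M w A).card := by
  have := hB.encard_eq_encard_of_isBase (opt_isBase (w := w) hE A)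
  rw [Set.encard_coe_eq_coe_finsetCard, Set.encard_coe_eq_coe_finsetCard] at this
  exact_mod_cast this

lemma card_opt_anti (hE : M.E = Set.univ) {A A' : Finset E} (h : A ⊆ A') :
    (opt M w A').card ≤ (opt M w A).card := by
  have h2 := (opt_isBasis (w := w) hE A).encard_eq_eRk
  have h1 := (opt_indep (w := w) hE A').encard_le_eRk_of_subset (X := M.E \ A)
    (fun x hx => ⟨by simp [hE], fun hA => (mem_opt.1 hx).1 (h hA)⟩)
  rw [← h2, Set.encard_coe_eq_coe_finsetCard, Set.encard_coe_eq_coe_finsetCard] at h1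
  exact_mod_cast h1

lemma y_eq (hE : M.E = Set.univ) {A : Finset E} (hA : (opt M w A).card = rk M) :
    y M w A = ((∑ e ∈ opt M w A, w e : ℝ) : EReal) := by
  refine le_antisymm (iInf₂_le (opt M w A) ⟨opt_isBase hE A, hA⟩) ?_
  exact le_iInf₂ fun B hB => EReal.coe_le_coe_iff.2 (opt_optimal hE hB.1).1

lemma erase_opt_subset (A : Finset E) (e : E) :
    (opt M w A).erase e ⊆ opt M w (insert e A) := by
  intro x hx
  obtain ⟨hxe, hx⟩ := Finset.mem_erase.1 hx
  refine mem_opt_of_subset (Finset.subset_insert e A) hx fun h => ?_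
  rcases Finset.mem_insert.1 h with h | h
  · exact hxe h
  · exact (mem_opt.1 hx).1 h

/-- The effect of the interdiction of an element `e` of the optimal basis if some element `x` enters
the optimal basis. -/
lemma opt_insert_of_mem (hE : M.E = Set.univ) {A : Finset E} {e x : E} (he : e ∈ opt M w A)
    (hx : x ∈ opt M w (insert e A)) (hx' : x ∉ opt M w A) :
    x ∈ opt M w (A ∪ opt M w A) ∧ M.Indep (insert x (opt M w A \ {e} : Set E)) ∧
      opt M w (insert e A) = insert x ((opt M w A).erase e) := by
  have hsub : insert x ((opt M w A).erase e) ⊆ opt M w (insert e A) :=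
    Finset.insert_subset hx (erase_opt_subset A e)
  have hx1 := (mem_opt.1 hx).1
  refine ⟨mem_opt_of_subset ?_ hx ?_, ?_, (Finset.eq_of_subset_of_card_le hsub ?_).symm⟩
  · exact Finset.insert_subset (Finset.mem_union_right _ he) Finset.subset_union_left
  · simp only [Finset.mem_insert, not_or] at hx1
    simp [hx', hx1.2]
  · refine (opt_indep (w := w) hE (insert e A)).subset ?_
    rw [← Finset.coe_erase, ← Finset.coe_insert]
    exact_mod_cast hsub
  · rw [Finset.card_insert_of_notMem (fun h => hx' (Finset.mem_of_mem_erase h)),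
      Finset.card_erase_add_one he]
    exact card_opt_anti hE (Finset.subset_insert _ _)

/-- The effect of the interdiction of an element that has no replacement element. -/
lemma opt_insert_of_forall (hE : M.E = Set.univ) {A : Finset E} {e : E} (he : e ∈ opt M w A)
    (h : ∀ r ∈ opt M w (A ∪ opt M w A), ¬ M.Indep (insert r (opt M w A \ {e} : Set E))) :
    opt M w (insert e A) = (opt M w A).erase e := by
  refine Finset.Subset.antisymm (fun x hx => ?_) (erase_opt_subset A e)
  by_cases hxo : x ∈ opt M w A
  · refine Finset.mem_erase.2 ⟨?_, hxo⟩
    rintro rfl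
    exact (mem_opt.1 hx).1 (Finset.mem_insert_self _ _)
  · obtain ⟨h1, h2, -⟩ := opt_insert_of_mem hE he hx hxo
    exact absurd h2 (h x h1)

/-- The effect of the interdiction of an element with replacement element `r`. -/
lemma opt_insert_of_indep (hE : M.E = Set.univ) {A : Finset E} {e r : E} (he : e ∈ opt M w A)
    (hr : r ∈ opt M w (A ∪ opt M w A))
    (hi : M.Indep (insert r (opt M w A \ {e} : Set E)))
    (hmin : ∀ r' ∈ opt M w (A ∪ opt M w A), M.Indep (insert r' (opt M w A \ {e} : Set E)) →
      key w r ≤ key w r') :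
    opt M w (insert e A) = insert r ((opt M w A).erase e) := by
  have hr1 : r ∉ A ∧ r ∉ opt M w A := by simpa using (mem_opt.1 hr).1
  have hrA : r ∉ insert e A := by
    have : r ≠ e := by rintro rfl; exact hr1.2 he
    simp [this, hr1.1]
  -- Some element must enter: otherwise the old basis without e would span r, against `hi`.
  obtain ⟨x, hx, hxo⟩ : ∃ x ∈ opt M w (insert e A), x ∉ opt M w A := by
    by_contra! hcon
    have hsub : (opt M w (insert e A) : Set E) ⊆ (opt M w A \ {e} : Set E) := by
      intro x hx
      refine ⟨hcon x hx, ?_⟩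
      rintro rfl
      exact (mem_opt.1 hx).1 (Finset.mem_insert_self _ _)
    have hc := (opt_isBasis (w := w) hE (insert e A)).subset_closure ⟨by simp [hE], hrA⟩
    have hm := (hi.subset (Set.subset_insert _ _)).insert_indep_iff_of_notMem (e := r)
      (by simp [hr1.2])
    exact (hm.1 hi).2 (M.closure_subset_closure hsub hc)
  obtain ⟨h1, h2, h3⟩ := opt_insert_of_mem hE he hx hxo
  suffices x = r from this ▸ h3
  by_contra hne
  -- If x were not r, exchanging x for r would be possible, forcing x below r, while `hmin` says the
  -- opposite.
  refine (hmin x h1 h2).not_gt (key_lt_of_exchange hE (z := r) hrA ?_ ?_)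
  · rw [h3]; simp [Ne.symm hne, hr1.2]
  · refine hi.subset (Set.insert_subset_insert ?_)
    rw [h3]
    intro u
    simp only [Finset.coe_insert, Finset.coe_erase, Set.mem_sdiff, Set.mem_insert_iff,
      Set.mem_singleton_iff]
    tauto

/-- Without a replacement the basis would just lose e, and the rank would drop. -/
lemma exists_replacement (hE : M.E = Set.univ) {A : Finset E} {e : E} (he : e ∈ opt M w A)
    (hc : (opt M w A).card ≤ (opt M w (insert e A)).card) :
    ∃ r ∈ opt M w (A ∪ opt M w A), M.Indep (insert r (opt M w A \ {e} : Set E)) := by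
  by_contra! hcon
  rw [opt_insert_of_forall hE he hcon] at hc
  exact (Finset.card_erase_lt_of_mem he).not_ge hc

end OptimalBasis

/-! ### Relevant sets, most vital sets and domination. -/

section Relevant

variable {E : Type} [Fintype E] [LinearOrder E] {M : Matroid E} {w : E → ℝ}

/-- Every proper subset of `F` leaves an element of `F` in the optimal basis. -/
def IsExhaustible (M : Matroid E) (w : E → ℝ) (F : Finset E) : Prop :=
  ∀ A ⊂ F, ∃ x ∈ F, x ∈ opt M w A

/-- Take the first stage of the chain not contained in A. Its missing element was in the optimal
basis after deleting a subset of A, so it is still there after deleting A. -/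
lemma Chain.exists_mem_opt (hE : M.E = Set.univ) {F C : Finset E} (hC : Chain M w F C)
    {A : Finset E} (hA : ¬ C ⊆ A) : ∃ x ∈ F, x ∈ opt M w A := by
  induction hC with
  | empty => simp at hA
  | @step C B hC hB hne ih =>
    rw [isOptBasis_iff hE] at hB
    subst hB
    by_cases h : C ⊆ A
    · obtain ⟨x, hx, hxA⟩ := Finset.not_subset.1 hA
      rcases Finset.mem_union.1 hx with hx | hx
      · exact absurd (h hx) hxA
      · rw [Finset.mem_inter] at hx
        exact ⟨x, hx.1, mem_opt_of_subset h hx.2 hxA⟩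
    · exact ih h

/-- Exhaustibility says exactly that the next part is non-empty as long as the chain has not reached
F. -/
lemma IsExhaustible.chain (hE : M.E = Set.univ) {F : Finset E} (hF : IsExhaustible M w F)
    {A : Finset E} (hAF : A ⊆ F) (hA : Chain M w F A) : Chain M w F F := by
  obtain ⟨n, hn⟩ : ∃ n, n = (F \ A).card := ⟨_, rfl⟩
  induction n using Nat.strong_induction_on generalizing A with
  | _ n ih =>
    rcases hAF.eq_or_ssubset with rfl | hss
    · exact hA
    obtain ⟨x, hx, hxo⟩ := hF A hss
    refine ih _ ?_ (Finset.union_subset hAF Finset.inter_subset_left)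
      (hA.step ((isOptBasis_iff hE).2 rfl) ⟨x, Finset.mem_inter.2 ⟨hx, hxo⟩⟩) rfl
    rw [hn]
    refine Finset.card_lt_card (Finset.ssubset_iff_of_subset ?_ |>.2 ⟨x, ?_, ?_⟩)
    · exact Finset.sdiff_subset_sdiff le_rfl Finset.subset_union_left
    · simp [hx, (mem_opt.1 hxo).1]
    · simp [hx, hxo]

lemma isRelevant_iff (hE : M.E = Set.univ) {ℓ : ℕ} {F : Finset E} :
    IsRelevant M w ℓ F ↔ F.card = ℓ ∧ IsExhaustible M w F :=
  and_congr_right fun _ => ⟨fun h _ hA => h.exists_mem_opt hE hA.2,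
    fun h => h.chain hE (Finset.empty_subset _) .empty⟩

lemma isExhaustible_empty : IsExhaustible M w ∅ := fun A hA => absurd hA (by simp)

/-- A proper subset containing A misses e, which survives in the basis. One not containing A becomes
a proper subset of A on removing e, and the element of A it yields differs from e. -/
lemma IsExhaustible.insert {A : Finset E} (hA : IsExhaustible M w A) {e : E}
    (he : e ∈ opt M w A) : IsExhaustible M w (insert e A) := by
  intro A' hA'
  by_cases h : A ⊆ A'
  · have heA : e ∉ A' := fun h' => hA'.2 (Finset.insert_subset h' h)
    exact ⟨e, Finset.mem_insert_self _ _, mem_opt_of_subset h he heA⟩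
  have hss : A'.erase e ⊂ A := by
    refine ⟨fun x hx => ?_, fun h' => h (h'.trans (Finset.erase_subset _ _))⟩
    rw [Finset.mem_erase] at hx
    exact (Finset.mem_insert.1 (hA'.1 hx.2)).resolve_left hx.1
  obtain ⟨x, hx, hxo⟩ := hA _ hss
  refine ⟨x, Finset.mem_insert_of_mem hx, mem_opt_of_subset (Finset.erase_subset _ _) hxo fun h' => ?_⟩
  refine (mem_opt.1 hxo).1 (Finset.mem_erase.2 ⟨?_, h'⟩)
  rintro rfl
  exact (mem_opt.1 he).1 hx

/-- A set that is not exhaustible contains an exhaustible set whose optimal basis it avoids. -/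
lemma exists_isExhaustible_disjoint {F : Finset E} (hF : ¬ IsExhaustible M w F) :
    ∃ A ⊂ F, IsExhaustible M w A ∧ Disjoint F (opt M w A) := by
  have hne : (F.ssubsets.filter fun A => Disjoint F (opt M w A)).Nonempty := by
    unfold IsExhaustible at hF
    push Not at hF
    obtain ⟨A, hA, h⟩ := hF
    exact ⟨A, by simpa [hA] using Finset.disjoint_left.2 h⟩
  -- A of least cardinality is exhaustible: a smaller A' leaves some x of F in its basis, and x
  -- outside A would survive into the basis of A, which avoids F.
  obtain ⟨A, hA, hmin⟩ := Finset.exists_min_image _ Finset.card hne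
  simp only [Finset.mem_filter, Finset.mem_ssubsets] at hA hmin
  refine ⟨A, hA.1, fun A' hA' => ?_, hA.2⟩
  have hA'F := hA'.trans hA.1
  obtain ⟨x, hx, hxo⟩ : ∃ x ∈ F, x ∈ opt M w A' := by
    by_contra! hcon
    exact (hmin A' ⟨hA'F, Finset.disjoint_left.2 hcon⟩).not_gt (Finset.card_lt_card hA')
  refine ⟨x, ?_, hxo⟩
  by_contra hxA
  exact Finset.disjoint_left.1 hA.2 hx (mem_opt_of_subset hA'.1 hxo hxA)

lemma IsExhaustible.exists_superset {A : Finset E} (hA : IsExhaustible M w A) {ℓ : ℕ}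
    (hcard : A.card ≤ ℓ) (hopt : ∀ G : Finset E, G.card < ℓ → (opt M w G).Nonempty) :
    ∃ F, A ⊆ F ∧ F.card = ℓ ∧ IsExhaustible M w F := by
  obtain ⟨n, hn⟩ : ∃ n, n = ℓ - A.card := ⟨_, rfl⟩
  induction n generalizing A with
  | zero => exact ⟨A, subset_rfl, by omega, hA⟩
  | succ n ih =>
    obtain ⟨e, he⟩ := hopt A (by omega)
    have hc : (Insert.insert e A).card = A.card + 1 :=
      Finset.card_insert_of_notMem (mem_opt.1 he).1
    obtain ⟨F, hF, h⟩ := ih (hA.insert he) (by omega) (by omega)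
    exact ⟨F, (Finset.subset_insert _ _).trans hF, h⟩

/-- All matroids `M_F` with at most `ℓ` removed elements have full rank. -/
lemma card_opt_eq (hE : M.E = Set.univ) {ℓ : ℕ} (hℓ : ℓ ≤ Fintype.card E)
    (h : ∀ F : Finset E, F.card = ℓ →
      ∃ B : Finset E, (M.delete (F : Set E)).IsBase (B : Set E) ∧ B.card = rk M)
    {F : Finset E} (hF : F.card ≤ ℓ) : (opt M w F).card = rk M := by
  obtain ⟨F', hFF', hF'⟩ := Finset.exists_superset_card_eq hF (by simpa using hℓ)
  obtain ⟨B, hB, hBc⟩ := h F' hF'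
  refine le_antisymm (card_opt_le hE F) ?_
  rw [← hBc, card_eq_of_isBase (w := w) hE hB]
  exact card_opt_anti hE hFF'

/-- An independent set of full rank size is a base of M, hence of any restriction containing it.
This makes values monotone in the deleted set. -/
lemma opt_isBase_of_subset (hE : M.E = Set.univ) {A A' : Finset E} (h : A ⊆ A')
    (hA' : (opt M w A').card = rk M) : (M.delete (A : Set E)).IsBase (opt M w A' : Set E) := by
  have hB : M.IsBase (opt M w A' : Set E) := by
    refine (opt_indep hE A').isBase_of_eRk_ge (Finset.finite_toSet _) ?_
    rw [(opt_indep hE A').eRk_eq_encard, eRank_eq_rk, Set.encard_coe_eq_coe_finsetCard, hA']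
  rw [Matroid.delete_isBase_iff]
  exact hB.isBasis_of_subset Set.sdiff_subset
    (fun _ hx => ⟨by simp [hE], fun hxA => (mem_opt.1 hx).1 (h hxA)⟩)

lemma y_mono (hE : M.E = Set.univ) {A A' : Finset E} (h : A ⊆ A')
    (hA' : (opt M w A').card = rk M) : y M w A ≤ y M w A' := by
  rw [y_eq hE hA']
  exact iInf₂_le _ ⟨opt_isBase_of_subset hE h hA', hA'⟩

/-- Were the values equal, the new optimal basis would be a second minimum weight basis of M_A, as
it lacks e. -/
lemma y_lt_insert (hE : M.E = Set.univ) {A : Finset E} {e : E} (he : e ∈ opt M w A)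
    (hc : (opt M w (insert e A)).card = rk M) (hu : ∃! B : Finset E, IsMinWeightBasis M w A B) :
    y M w A < y M w (insert e A) := by
  have hA : (opt M w A).card = rk M :=
    le_antisymm (card_opt_le hE A) (hc ▸ card_opt_anti hE (Finset.subset_insert _ _))
  have hB := opt_isBase_of_subset hE (Finset.subset_insert e A) hc
  rw [y_eq hE hA, y_eq hE hc, EReal.coe_lt_coe_iff]
  refine lt_of_le_of_ne (opt_optimal hE hB).1 fun heq => ?_
  have h := hu.unique ⟨hB, fun B' hB' => heq ▸ (opt_optimal hE hB').1⟩ (opt_isMinWeightBasis hE A)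
  exact (mem_opt.1 (h ▸ he)).1 (Finset.mem_insert_self _ _)

/-- The whole basis survives, and deletion cannot raise the rank. -/
lemma opt_eq_of_disjoint (hE : M.E = Set.univ) {A F : Finset E} (h : A ⊆ F)
    (hd : Disjoint F (opt M w A)) : opt M w F = opt M w A := by
  refine (Finset.eq_of_subset_of_card_le (fun x hx => ?_) (card_opt_anti hE h)).symm
  exact mem_opt_of_subset h hx (Finset.disjoint_right.1 hd hx)

/-- The conclusion records equal bases rather than an inequality of values, so that it can be
transported to other parameters with the same order of elements. -/
lemma exists_isExhaustible_dominating (hE : M.E = Set.univ) {ℓ : ℕ}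
    (hopt : ∀ G : Finset E, G.card < ℓ → (opt M w G).Nonempty) {F : Finset E} (hF : F.card = ℓ) :
    ∃ F', F'.card = ℓ ∧ IsExhaustible M w F' ∧ ∃ A ⊆ F', opt M w A = opt M w F := by
  by_cases h : IsExhaustible M w F
  · exact ⟨F, hF, h, F, subset_rfl, rfl⟩
  obtain ⟨A, hAF, hA, hd⟩ := exists_isExhaustible_disjoint h
  obtain ⟨F', hAF', hF', hex⟩ := hA.exists_superset (hF ▸ Finset.card_le_card hAF.1) hopt
  exact ⟨F', hF', hex, A, hAF', (opt_eq_of_disjoint hE hAF.1 hd).symm⟩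

lemma y_le_of_opt_eq (hE : M.E = Set.univ) {A F F' : Finset E} (hAF' : A ⊆ F')
    (hA : opt M w A = opt M w F) (hF : (opt M w F).card = rk M)
    (hF' : (opt M w F').card = rk M) : y M w F ≤ y M w F' := by
  rw [y_eq hE hF, ← hA, ← y_eq hE (hA ▸ hF)]
  exact y_mono hE hAF' hF'

omit [LinearOrder E] in
lemma exists_isMostVital (M : Matroid E) (w : E → ℝ) {ℓ : ℕ} (hℓ : ℓ ≤ Fintype.card E) :
    ∃ F, IsMostVital M w ℓ F := by
  obtain ⟨F₀, -, hF₀⟩ := Finset.exists_superset_card_eq (s := (∅ : Finset E)) (by simp)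
    (show ℓ ≤ Fintype.card E from hℓ)
  obtain ⟨F, hF, hmax⟩ := Finset.exists_max_image (Finset.univ.filter fun F : Finset E => F.card = ℓ)
    (y M w) ⟨F₀, by simpa using hF₀⟩
  exact ⟨F, by simpa using hF, fun G hG => hmax G (by simpa using hG)⟩

/-- Otherwise F has the value of a smaller exhaustible A, and any ℓ-element set containing A and one
element of its optimal basis is strictly better. -/
lemma IsMostVital.isExhaustible (hE : M.E = Set.univ) {ℓ : ℕ} (hk : 0 < rk M)
    (hopt : ∀ G : Finset E, G.card ≤ ℓ → (opt M w G).card = rk M)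
    (hu : ∀ G : Finset E, G.card < ℓ → ∃! B : Finset E, IsMinWeightBasis M w G B)
    {F : Finset E} (hF : IsMostVital M w ℓ F) : IsExhaustible M w F := by
  by_contra h
  obtain ⟨A, hAF, hA, hd⟩ := exists_isExhaustible_disjoint h
  have hcA : A.card < ℓ := hF.1 ▸ Finset.card_lt_card hAF
  have hne : ∀ G : Finset E, G.card < ℓ → (opt M w G).Nonempty := fun G hG =>
    Finset.card_pos.1 (by rw [hopt G hG.le]; exact hk)
  obtain ⟨e, he⟩ := hne A hcA
  have hce : (insert e A).card ≤ ℓ := (Finset.card_insert_le _ _).trans hcA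
  obtain ⟨F', hAF', hF', -⟩ := (hA.insert he).exists_superset hce hne
  have h1 : y M w F ≤ y M w A :=
    y_le_of_opt_eq hE subset_rfl (opt_eq_of_disjoint hE hAF.1 hd).symm (hopt _ hF.1.le) (hopt _ hcA.le)
  have h2 := y_lt_insert hE he (hopt _ hce) (hu A hcA)
  have h3 := y_mono hE hAF' (hopt _ hF'.le)
  exact (h1.trans_lt (h2.trans_le h3)).not_ge (hF.2 F' hF')

lemma opt_congr {w' : E → ℝ} (h : ∀ x z, key w x < key w z ↔ key w' x < key w' z) :
    opt M w = opt M w' := by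
  ext A x
  simp only [mem_opt, h]

-- If two elements changed their order, the intermediate value theorem would give a point of J at
-- which their weights agree.
omit [Fintype E] [LinearOrder E] in
lemma weight_lt_of_injective {a b : E → ℝ} {J : Set ℝ} (hJ : J.OrdConnected)
    (hinj : ∀ μ ∈ J, Function.Injective (weight a b μ)) {lam μ : ℝ} (hl : lam ∈ J) (hμ : μ ∈ J)
    {x z : E} (h : weight a b lam x < weight a b lam z) : weight a b μ x < weight a b μ z := by
  by_contra! hle
  have hsub : Set.uIcc lam μ ⊆ J := hJ.uIcc_subset hl hμ
  have hc : ContinuousOn (fun t => weight a b t z - weight a b t x) (Set.uIcc lam μ) := by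
    unfold weight
    fun_prop
  obtain ⟨t, ht, ht0⟩ := intermediate_value_uIcc hc
    (show (0 : ℝ) ∈ _ from Set.mem_uIcc.2 (Or.inr ⟨by linarith, by linarith⟩))
  have := hinj t (hsub ht) (sub_eq_zero.1 ht0)
  subst this
  exact lt_irrefl _ h

lemma opt_weight_eq {a b : E → ℝ} {J : Set ℝ} (hJ : J.OrdConnected)
    (hinj : ∀ μ ∈ J, Function.Injective (weight a b μ)) {lam μ : ℝ} (hl : lam ∈ J) (hμ : μ ∈ J) :
    opt M (weight a b lam) = opt M (weight a b μ) := by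
  have hlt : ∀ ν ∈ J, ∀ x z, key (weight a b ν) x < key (weight a b ν) z ↔
      weight a b ν x < weight a b ν z := fun ν hν x z => by
    rw [key_lt_iff]
    refine ⟨fun h => h.resolve_right fun h' => ?_, Or.inl⟩
    exact h'.2.ne (hinj ν hν h'.1)
  refine opt_congr fun x z => ?_
  rw [hlt lam hl, hlt μ hμ]
  exact ⟨weight_lt_of_injective hJ hinj hl hμ, weight_lt_of_injective hJ hinj hμ hl⟩

end Relevant

/-! ### Values and step counts of composed computations. -/

section Steps

variable {α β : Type}

@[simp] lemma bind_val (p : Timed α) (q : α → Timed β) : (p >>= q).val = (q p.val).val := rfl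

@[simp] lemma bind_time (p : Timed α) (q : α → Timed β) :
    (p >>= q).time = p.time + (q p.val).time := rfl

@[simp] lemma pure_val (x : α) : (pure x : Timed α).val = x := rfl

@[simp] lemma pure_time (x : α) : (pure x : Timed α).time = 0 := rfl

@[simp] lemma tick_time : tick.time = 1 := rfl

end Steps

/-! ### Correctness and cost of merge sort. -/

section Sorting

variable {E : Type} [LinearOrder E] {w : E → ℝ}

/-- The list is sorted by weight. -/
def KeySorted (w : E → ℝ) (l : List E) : Prop := l.Pairwise fun x z => key w x ≤ key w z

lemma merge_perm (xs ys : List E) : (merge w xs ys).val.Perm (xs ++ ys) := by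
  fun_induction merge w xs ys with
  | case1 ys => simp
  | case2 x xs => simp
  | case3 x xs z zs ih₁ ih₂ =>
    simp only [bind_val]
    split
    · simpa using ih₁
    · simp only [bind_val, pure_val]
      exact (ih₂.cons z).trans (List.perm_middle (l₁ := x :: xs)).symm

lemma KeySorted.merge {xs ys : List E} (hx : KeySorted w xs) (hy : KeySorted w ys) :
    KeySorted w (merge w xs ys).val := by
  fun_induction MatroidInterdiction.merge w xs ys with
  | case1 ys => simpa using hy
  | case2 x xs => simpa using hx
  | case3 x xs z zs ih₁ ih₂ =>
    simp only [bind_val]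
    split
    · rename_i h
      simp only [bind_val, pure_val]
      refine List.pairwise_cons.2 ⟨fun u hu => ?_, ih₁ (List.pairwise_cons.1 hx).2 hy⟩
      rcases List.mem_append.1 ((merge_perm _ _).subset hu) with hu | hu
      · exact (List.pairwise_cons.1 hx).1 u hu
      · rcases List.mem_cons.1 hu with rfl | hu
        · exact h
        · exact h.trans ((List.pairwise_cons.1 hy).1 u hu)
    · rename_i h
      simp only [bind_val, pure_val]
      refine List.pairwise_cons.2 ⟨fun u hu => ?_, ih₂ hx (List.pairwise_cons.1 hy).2⟩
      rcases List.mem_append.1 ((merge_perm _ _).subset hu) with hu | hu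
      · rcases List.mem_cons.1 hu with rfl | hu
        · exact (not_le.1 h).le
        · exact (not_le.1 h).le.trans ((List.pairwise_cons.1 hx).1 u hu)
      · exact (List.pairwise_cons.1 hy).1 u hu

lemma merge_time_le (xs ys : List E) : (merge w xs ys).time ≤ xs.length + ys.length + 1 := by
  fun_induction merge w xs ys with
  | case1 => simp
  | case2 => simp
  | case3 x xs z zs ih₁ ih₂ =>
    simp only [bind_time, tick_time, List.length_cons] at *
    split <;> simp only [bind_time, pure_time] <;> omega

lemma mergePairs_perm (ls : List (List E)) : (mergePairs w ls).val.flatten.Perm ls.flatten := by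
  fun_induction mergePairs w ls with
  | case1 => simp
  | case2 l => simp
  | case3 l₁ l₂ ls ih =>
    simp only [bind_val, pure_val, List.flatten_cons]
    rw [← List.append_assoc]
    exact (merge_perm _ _).append ih

lemma keySorted_of_mem_mergePairs {ls : List (List E)} (h : ∀ l ∈ ls, KeySorted w l) :
    ∀ l ∈ (mergePairs w ls).val, KeySorted w l := by
  fun_induction mergePairs w ls with
  | case1 => simp
  | case2 l => simpa using h
  | case3 l₁ l₂ ls ih =>
    simp only [List.mem_cons, forall_eq_or_imp] at h
    simp only [bind_val, pure_val, List.mem_cons, forall_eq_or_imp]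
    exact ⟨h.1.merge h.2.1, ih h.2.2⟩

lemma length_mergePairs (ls : List (List E)) :
    (mergePairs w ls).val.length = (ls.length + 1) / 2 := by
  fun_induction mergePairs w ls <;> simp at *
  omega

lemma mergePairs_time_le (ls : List (List E)) :
    (mergePairs w ls).time ≤ ls.flatten.length + ls.length + 1 := by
  fun_induction mergePairs w ls with
  | case1 => simp
  | case2 l => simp
  | case3 l₁ l₂ ls ih =>
    have := merge_time_le (w := w) l₁ l₂
    simp only [bind_time, tick_time, pure_time, List.flatten_cons, List.length_append, List.length_cons]
    omega

lemma mergeAll_spec {n : ℕ} {ls : List (List E)} (hn : ls.length ≤ n) :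
    (mergeAll w n ls).val.Perm ls.flatten ∧
      ((∀ l ∈ ls, KeySorted w l) → KeySorted w (mergeAll w n ls).val) := by
  fun_induction mergeAll w n ls with
  | case1 => simp [KeySorted]
  | case2 => simp
  | case3 => simp at hn
  | case4 n l₁ l₂ ls ih =>
    simp only [bind_val] at ih ⊢
    obtain ⟨h1, h2⟩ := ih (mergePairs w (l₁ :: l₂ :: ls)).val
      (by rw [length_mergePairs]; simp at hn ⊢; omega)
    exact ⟨h1.trans (mergePairs_perm _), fun h => h2 (keySorted_of_mem_mergePairs h)⟩

/-- Each round halves the number of lists, so the number of rounds is governed by r and not by the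
allowance n. -/
lemma mergeAll_time_le {n : ℕ} {ls : List (List E)} {r : ℕ} (hr : ls.length ≤ 2 ^ r) :
    (mergeAll w n ls).time ≤ r * (ls.flatten.length + ls.length + 2) + 1 := by
  fun_induction mergeAll w n ls generalizing r with
  | case1 => simp
  | case2 => simp
  | case3 => simp
  | case4 n l₁ l₂ ls ih =>
    have h0 := mergePairs_time_le (w := w) (l₁ :: l₂ :: ls)
    have h1 := length_mergePairs (w := w) (l₁ :: l₂ :: ls)
    have h2 := (mergePairs_perm (w := w) (l₁ :: l₂ :: ls)).length_eq
    have h3 : 2 ≤ (l₁ :: l₂ :: ls).length := by simp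
    generalize l₁ :: l₂ :: ls = L at *
    obtain _ | r := r
    · omega
    have h4 := ih (mergePairs w L).val (r := r) (by rw [h1]; rw [pow_succ] at hr; omega)
    simp only [bind_time, tick_time]
    have h5 : r * ((mergePairs w L).val.flatten.length + (mergePairs w L).val.length + 2) ≤
        r * (L.flatten.length + L.length + 2) := Nat.mul_le_mul_left _ (by omega)
    rw [Nat.succ_mul]
    omega

omit [LinearOrder E] in
lemma singletons_val (xs : List E) : (singletons xs).val = xs.map fun x => [x] := by
  induction xs with
  | nil => rfl
  | cons x xs ih => simp [singletons, ih]

omit [LinearOrder E] in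
lemma singletons_time (xs : List E) : (singletons xs).time = xs.length + 1 := by
  induction xs with
  | nil => rfl
  | cons x xs ih => simp [singletons, ih]; omega

omit [LinearOrder E] in
lemma length_val (ls : List (List E)) : (length ls).val = ls.length := by
  induction ls with
  | nil => rfl
  | cons x xs ih => simp [length, ih]

omit [LinearOrder E] in
lemma length_time (ls : List (List E)) : (length ls).time = ls.length + 1 := by
  induction ls with
  | nil => rfl
  | cons x xs ih => simp [length, ih]; omega

omit [LinearOrder E] in
lemma flatten_singletons (xs : List E) : (xs.map fun x => [x]).flatten = xs := by
  induction xs <;> simp_all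

lemma sort_perm (es : List E) : (sort w es).val.Perm es := by
  have := (mergeAll_spec (w := w) (n := es.length) (ls := es.map fun x => [x]) (by simp)).1
  simpa [sort, singletons_val, length_val, flatten_singletons] using this

lemma keySorted_sort (es : List E) : KeySorted w (sort w es).val := by
  have := (mergeAll_spec (w := w) (n := es.length) (ls := es.map fun x => [x]) (by simp)).2
    (by simp [KeySorted])
  simpa [sort, singletons_val, length_val] using this

lemma sort_time_le {es : List E} {r : ℕ} (hr : es.length ≤ 2 ^ r) :
    (sort w es).time ≤ r * (2 * es.length + 2) + 2 * es.length + 4 := by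
  have := mergeAll_time_le (w := w) (n := es.length) (ls := es.map fun x => [x]) (r := r)
    (by simpa using hr)
  simp only [flatten_singletons, List.length_map] at this
  simp only [sort, singletons_val, length_val, bind_time, tick_time, singletons_time, length_time,
    List.length_map]
  rw [two_mul]
  omega

end Sorting

/-! ### Elementary list procedures. -/

section ListOperations

variable {E : Type} [LinearOrder E]

omit [LinearOrder E] in
lemma append_val {α : Type} (xs ys : List α) : (append xs ys).val = xs ++ ys := by
  induction xs with
  | nil => rfl
  | cons x xs ih => simp [append, ih]

omit [LinearOrder E] in
lemma append_time {α : Type} (xs ys : List α) : (append xs ys).time = xs.length + 1 := by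
  induction xs with
  | nil => rfl
  | cons x xs ih => simp [append, ih]; omega

lemma member_val (e : E) (l : List E) : (member e l).val = true ↔ e ∈ l := by
  induction l with
  | nil => simp [member]
  | cons x xs ih =>
    simp only [member, bind_val, List.mem_cons]
    split
    · simp_all
    · rename_i h
      rw [ih]
      simp [Ne.symm h]

lemma member_time_le (e : E) (l : List E) : (member e l).time ≤ l.length + 1 := by
  induction l with
  | nil => simp [member]
  | cons x xs ih =>
    simp only [member, bind_time, tick_time, List.length_cons]
    split
    · simp
    · omega

lemma erase_val (e : E) (l : List E) : (erase e l).val = l.erase e := by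
  induction l with
  | nil => rfl
  | cons x xs ih =>
    simp only [erase, bind_val, List.erase_cons]
    split
    · simp_all
    · simp_all

lemma erase_time_le (e : E) (l : List E) : (erase e l).time ≤ l.length + 1 := by
  induction l with
  | nil => simp [erase]
  | cons x xs ih =>
    simp only [erase, bind_time, tick_time, List.length_cons]
    split
    · simp
    · simp only [bind_time, pure_time]; omega

omit [LinearOrder E] in
lemma totalWeight_val (w : E → ℝ) (l : List E) : (totalWeight w l).val = (l.map w).sum := by
  induction l with
  | nil => rfl
  | cons x xs ih => simp [totalWeight, ih]

omit [LinearOrder E] in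
lemma totalWeight_time (w : E → ℝ) (l : List E) : (totalWeight w l).time = l.length + 1 := by
  induction l with
  | nil => rfl
  | cons x xs ih => simp [totalWeight, ih]; omega

end ListOperations

/-! ### The greedy algorithm, successive bases and their update. -/

section Greedy

variable {E : Type} [Fintype E] [LinearOrder E] {M : Matroid E} {w : E → ℝ} {f : ℕ}

omit [Fintype E] [LinearOrder E] in
lemma indepTest_val (l : List E) : (indepTest M f l).val = true ↔ M.Indep {x | x ∈ l} := by
  simp [indepTest]

omit [Fintype E] [LinearOrder E] in
lemma indepTest_time (l : List E) : (indepTest M f l).time = f := rfl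

omit [Fintype E] [LinearOrder E] in
lemma greedy_cons_val (x : E) (xs cur : List E) [Decidable (M.Indep {z | z ∈ x :: cur})] :
    (greedy M f (x :: xs) cur).val =
      if M.Indep {z | z ∈ x :: cur} then
        (x :: (greedy M f xs (x :: cur)).val.1, (greedy M f xs (x :: cur)).val.2)
      else ((greedy M f xs cur).val.1, x :: (greedy M f xs cur).val.2) := by
  simp only [greedy, bind_val, indepTest_val]
  split <;> rfl

/-- The invariant `hcur` says that the accepted elements are those of `opt` no longer on the list.
They include all elements of `opt` below the current x, so they span x whenever x is not in `opt`.
-/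
lemma greedy_val (hE : M.E = Set.univ) {A : Finset E} {xs cur : List E}
    (hs : xs.Pairwise fun x z => key w x < key w z) (hxs : ∀ x ∈ xs, x ∉ A)
    (hcur : ∀ z, z ∈ cur ↔ z ∈ opt M w A ∧ z ∉ xs) :
    (greedy M f xs cur).val = (xs.filter (· ∈ opt M w A), xs.filter (· ∉ opt M w A)) := by
  classical
  induction xs generalizing cur with
  | nil => rfl
  | cons x xs ih =>
    obtain ⟨hx, hs⟩ := List.pairwise_cons.1 hs
    have hxA := hxs x List.mem_cons_self
    have hx' : x ∉ xs := fun h => lt_irrefl _ (hx x h)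
    rw [greedy_cons_val]
    by_cases ho : x ∈ opt M w A
    · rw [if_pos, ih hs (fun z hz => hxs z (List.mem_cons_of_mem _ hz))]
      · simp [ho]
      · intro z
        by_cases hz : z = x
        · subst hz; simp [ho, hx']
        · simp [hcur, hz]
      · refine (opt_indep (w := w) hE A).subset fun z hz => ?_
        rcases List.mem_cons.1 hz with rfl | hz
        · exact ho
        · exact ((hcur z).1 hz).1
    · rw [if_neg, ih hs (fun z hz => hxs z (List.mem_cons_of_mem _ hz))]
      · simp [ho]
      · intro z
        by_cases hz : z = x
        · subst hz; simp [ho, hcur]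
        · simp [hcur, hz]
      · intro hi
        have hxc : x ∉ {z | z ∈ cur} := fun h => ho ((hcur x).1 h).1
        have hi' : M.Indep (insert x {z | z ∈ cur}) := by
          convert hi using 1; ext z; simp
        refine (((hi'.subset (Set.subset_insert _ _)).insert_indep_iff_of_notMem hxc).1 hi').2
          (M.closure_subset_closure ?_ (mem_closure_opt_of_notMem (w := w) hE hxA ho))
        rintro z ⟨hz, hlt⟩
        refine (hcur z).2 ⟨hz, fun h => ?_⟩
        rcases List.mem_cons.1 h with rfl | h
        · exact lt_irrefl _ hlt
        · exact lt_asymm hlt (hx z h)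

omit [Fintype E] [LinearOrder E] in
lemma length_greedy_snd_le (xs cur : List E) : (greedy M f xs cur).val.2.length ≤ xs.length := by
  classical
  induction xs generalizing cur with
  | nil => simp [greedy]
  | cons x xs ih =>
    rw [greedy_cons_val]
    split
    · exact (ih _).trans (by simp)
    · simpa using ih _

omit [Fintype E] [LinearOrder E] in
lemma greedy_time_le (xs cur : List E) : (greedy M f xs cur).time ≤ xs.length * (f + 1) + 1 := by
  induction xs generalizing cur with
  | nil => simp [greedy]
  | cons x xs ih =>
    simp only [greedy, bind_time, tick_time, indepTest_time, List.length_cons, Nat.succ_mul]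
    split
    · have := ih (x :: cur)
      simp only [bind_time, pure_time]; omega
    · have := ih cur
      simp only [bind_time, pure_time]; omega

/-- `Ts` consists of successive optimal bases, each one in the matroid in which the elements of `A` and
of the previous ones are deleted. -/
def Layers (M : Matroid E) (w : E → ℝ) : Finset E → List (List E) → Prop
  | _, [] => True
  | A, T :: Ts => T.Nodup ∧ T.toFinset = opt M w A ∧ Layers M w (A ∪ opt M w A) Ts

lemma Layers.toFinset_headD {A : Finset E} {Ts : List (List E)} (h : Layers M w A Ts)
    (hne : Ts ≠ []) : (Ts.headD []).toFinset = opt M w A := by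
  cases Ts with
  | nil => exact absurd rfl hne
  | cons T Ts => exact h.2.1

lemma Layers.length_le (hE : M.E = Set.univ) {A : Finset E} {Ts : List (List E)}
    (h : Layers M w A Ts) : ∀ T ∈ Ts, T.length ≤ rk M := by
  induction Ts generalizing A with
  | nil => simp
  | cons T Ts ih =>
    simp only [List.mem_cons, forall_eq_or_imp]
    refine ⟨?_, ih h.2.2⟩
    rw [← List.toFinset_card_of_nodup h.1, h.2.1]
    exact card_opt_le hE A

lemma layers_bases (hE : M.E = Set.univ) {A : Finset E} {xs : List E} (n : ℕ)
    (hs : xs.Pairwise fun x z => key w x < key w z) (hxs : ∀ x, x ∈ xs ↔ x ∉ A) :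
    Layers M w A (bases M f n xs).val := by
  induction n generalizing A xs with
  | zero => trivial
  | succ n ih =>
    have hg := greedy_val (f := f) (cur := []) hE hs (fun x hx => (hxs x).1 hx) (fun z => by
      simpa [hxs] using fun h => (mem_opt.1 h).1)
    change Layers M w A ((greedy M f xs []).val.1 :: (bases M f n (greedy M f xs []).val.2).val)
    rw [hg]
    refine ⟨(hs.imp fun h => ?_).filter _, ?_, ih (hs.filter _) fun x => ?_⟩
    · rintro rfl; exact lt_irrefl _ h
    · ext x
      simpa [hxs] using fun h => (mem_opt.1 h).1
    · simp [hxs]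

omit [Fintype E] [LinearOrder E] in
lemma length_bases (n : ℕ) (xs : List E) : (bases M f n xs).val.length = n := by
  induction n generalizing xs with
  | zero => rfl
  | succ n ih => exact congrArg (· + 1) (ih _)

omit [Fintype E] [LinearOrder E] in
lemma bases_time_le (n : ℕ) (xs : List E) :
    (bases M f n xs).time ≤ n * (xs.length * (f + 1) + 2) + 1 := by
  induction n generalizing xs with
  | zero => simp [bases]
  | succ n ih =>
    have h1 := greedy_time_le (M := M) (f := f) xs []
    have h2 := ih (greedy M f xs []).val.2
    have h3 : n * ((greedy M f xs []).val.2.length * (f + 1) + 2) ≤ n * (xs.length * (f + 1) + 2) := by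
      gcongr
      exact length_greedy_snd_le _ _
    simp only [bases, bind_time, tick_time, pure_time]
    rw [Nat.succ_mul]
    omega

omit [Fintype E] in
lemma search_spec (S xs : List E) (best : Option E) :
    ((search M w f S xs best).val = none → best = none ∧ ∀ x ∈ xs, ¬ M.Indep {u | u ∈ x :: S}) ∧
    ∀ x, (search M w f S xs best).val = some x →
      (best = some x ∨ x ∈ xs ∧ M.Indep {u | u ∈ x :: S}) ∧
      (∀ z, best = some z → key w x ≤ key w z) ∧
      ∀ z ∈ xs, M.Indep {u | u ∈ z :: S} → key w x ≤ key w z := by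
  induction xs generalizing best with
  | nil => simp +contextual [search]
  | cons x xs ih =>
    simp only [search, bind_val]
    have hx := ih (some x)
    by_cases hi : M.Indep {u | u ∈ x :: S}
    · rw [if_pos ((indepTest_val _).2 hi)]
      cases best with
      | none => grind
      | some z =>
        have hz := ih (some z)
        dsimp only
        split <;> grind
    · rw [if_neg (mt (indepTest_val _).1 hi)]
      have hb := ih best
      grind

omit [Fintype E] in
lemma search_time_le (S xs : List E) (best : Option E) :
    (search M w f S xs best).time ≤ xs.length * (f + 1) + 1 := by
  induction xs generalizing best with
  | nil => simp [search]
  | cons x xs ih =>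
    have h1 := ih (some x)
    have h2 := ih best
    simp only [search, bind_time, tick_time, indepTest_time, List.length_cons, Nat.succ_mul]
    split
    · cases best with
      | none => dsimp only; omega
      | some z =>
        dsimp only
        split <;> omega
    · omega

lemma Layers.shift_none {A : Finset E} {Ts : List (List E)} (h : Layers M w A Ts) :
    Layers M w A (shift M w f none Ts).val := by
  induction Ts generalizing A with
  | nil => trivial
  | cons T Ts ih =>
    cases Ts with
    | nil => trivial
    | cons T' Ts => exact ⟨h.1, h.2.1, ih h.2.2⟩

/-- One element passes from layer to layer. Interdicting g enlarges the set deleted for the next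
layer by exactly the element x that enters, so the lemma applies again with x in place of g. -/
lemma Layers.shift_some (hE : M.E = Set.univ) {A : Finset E} {Ts : List (List E)}
    (h : Layers M w A Ts) {g : E} (hg : g ∈ opt M w A) :
    Layers M w (insert g A) (shift M w f (some g) Ts).val := by
  induction Ts generalizing A g with
  | nil => trivial
  | cons T Ts ih =>
    cases Ts with
    | nil => trivial
    | cons T' Ts =>
      obtain ⟨hT, hTA, hL⟩ := h
      have hT' := hL.2.1
      have hS : ∀ x, {u | u ∈ x :: T.erase g} = insert x (opt M w A \ {g} : Set E) := by
        intro x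
        ext u
        simp [← hTA, hT.mem_erase_iff, and_comm]
      have hSf : (T.erase g).toFinset = (opt M w A).erase g := by
        ext u
        simp [← hTA, hT.mem_erase_iff]
      have hmem : ∀ u, u ∈ T' ↔ u ∈ opt M w (A ∪ opt M w A) := by simp [← hT']
      obtain ⟨hs1, hs2⟩ := search_spec (M := M) (w := w) (f := f) (T.erase g) T' none
      simp only [hS, hmem] at hs1 hs2
      simp only [shift, bind_val, erase_val]
      split
      · rename_i hn
        have ho := opt_insert_of_forall hE hg (hs1 hn).2
        refine ⟨hT.erase g, ho ▸ hSf, ?_⟩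
        -- Nothing entered, so the deeper layers see the same deleted set as before.
        have : insert g A ∪ opt M w (insert g A) = A ∪ opt M w A := by
          rw [ho]; ext u; simp; grind
        rw [this]
        exact hL.shift_none
      · rename_i x hx
        obtain ⟨h1, -, h3⟩ := hs2 x hx
        obtain ⟨hx1, hx2⟩ := h1.resolve_left (by simp)
        have ho := opt_insert_of_indep hE hg hx1 hx2 h3
        have hxT : x ∉ T := by
          have := (mem_opt.1 hx1).1
          simp only [← hTA, Finset.mem_union, List.mem_toFinset, not_or] at this
          exact this.2
        refine ⟨List.nodup_cons.2 ⟨fun h => hxT (List.mem_of_mem_erase h), hT.erase g⟩, ?_, ?_⟩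
        · rw [ho, ← hSf]; simp
        have : insert g A ∪ opt M w (insert g A) = insert x (A ∪ opt M w A) := by
          rw [ho]; ext u; simp; grind
        rw [this]
        exact ih hL hx1

omit [Fintype E] in
lemma length_shift (g : Option E) (Ts : List (List E)) :
    (shift M w f g Ts).val.length = Ts.length - 1 := by
  induction Ts generalizing g with
  | nil => simp [shift]
  | cons T Ts ih =>
    cases Ts with
    | nil => simp [shift]
    | cons T' Ts =>
      cases g with
      | none => simp [shift, ih]
      | some g =>
        simp only [shift, bind_val]
        split <;> simp [ih]

omit [Fintype E] in
lemma shift_time_le {k : ℕ} (g : Option E) {Ts : List (List E)} (h : ∀ T ∈ Ts, T.length ≤ k) :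
    (shift M w f g Ts).time ≤ Ts.length * (k * (f + 1) + k + 3) + 1 := by
  induction Ts generalizing g with
  | nil => simp [shift]
  | cons T Ts ih =>
    cases Ts with
    | nil => simp [shift]
    | cons T' Ts =>
      simp only [List.mem_cons, forall_eq_or_imp] at h ih
      rw [List.length_cons, Nat.succ_mul]
      cases g with
      | none =>
        have := ih none h.2
        simp only [shift, bind_time, tick_time, pure_time]
        omega
      | some g =>
        have h1 := erase_time_le g T
        have h2 := search_time_le (M := M) (w := w) (f := f) (erase g T).val T' none
        have h3 : T'.length * (f + 1) ≤ k * (f + 1) := Nat.mul_le_mul_right _ h.2.1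
        simp only [shift, bind_time, tick_time]
        split
        · have := ih none h.2
          simp only [bind_time, pure_time]
          omega
        · rename_i x _
          have := ih (some x) h.2
          simp only [bind_time, pure_time]
          omega

end Greedy

/-! ### Replacement elements. -/

section Replacement

variable {E : Type} [LinearOrder E] {M : Matroid E} {w : E → ℝ}

lemma isReplacement_of_replacement_eq {B S : List E} {e r : E}
    (h : replacement M w B S e = some r) : IsReplacement M w B S e r := by
  unfold replacement at h
  split at h
  · rename_i hex
    exact Option.some.inj h ▸ hex.choose_spec
  · simp at h

lemma exists_replacement_eq {B S : List E} {e : E} (h : ∃ r, IsReplacement M w B S e r) :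
    ∃ r, replacement M w B S e = some r :=
  ⟨h.choose, dif_pos h⟩

lemma isReplacement_of_mem_replacements {H : ℕ} {B S : List E} {p : E × E}
    (hp : p ∈ (replacements M w H B S).val) : p.1 ∈ B ∧ IsReplacement M w B S p.1 p.2 := by
  simp only [replacements, List.mem_filterMap, Option.map_eq_some_iff] at hp
  obtain ⟨e, he, r, hr, rfl⟩ := hp
  exact ⟨he, isReplacement_of_replacement_eq hr⟩

lemma map_fst_replacements {H : ℕ} {B S : List E} (h : ∀ e ∈ B, ∃ r, IsReplacement M w B S e r) :
    (replacements M w H B S).val.map Prod.fst = B := by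
  have : ∀ l : List E, (∀ e ∈ l, ∃ r, IsReplacement M w B S e r) →
      (l.filterMap fun e => (replacement M w B S e).map fun r => (e, r)).map Prod.fst = l := by
    intro l hl
    induction l with
    | nil => rfl
    | cons e l ih =>
      simp only [List.mem_cons, forall_eq_or_imp] at hl
      obtain ⟨r, hr⟩ := exists_replacement_eq hl.1
      rw [List.filterMap_cons_some (b := (e, r)) (by simp [hr]), List.map_cons, ih hl.2]
  exact this B h

lemma replacements_time {H : ℕ} (B S : List E) : (replacements M w H B S).time = H := rfl

end Replacement

/-! ### Invariants of the search tree and its output. -/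

section Nodes

variable {E : Type} [Fintype E] [LinearOrder E] {M : Matroid E} {w : E → ℝ} {f H ℓ i : ℕ}

/-- The data stored in a node of level `i` are correct. -/
structure Node.Valid (M : Matroid E) (w : E → ℝ) (ℓ i : ℕ) (s : Node E) : Prop where
  nodup_F : s.F.Nodup
  length_F : s.F.length = i
  nodup_forb : s.forb.Nodup
  forb_subset : s.forb ⊆ s.T0
  nodup_T0 : s.T0.Nodup
  toFinset_T0 : s.T0.toFinset = opt M w s.F.toFinset
  wT0_eq : s.wT0 = ∑ e ∈ opt M w s.F.toFinset, w e
  layers : Layers M w (s.F.toFinset ∪ opt M w s.F.toFinset) s.Ts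
  length_Ts : s.Ts.length + i = ℓ
  isExhaustible : IsExhaustible M w s.F.toFinset

namespace Node.Valid

variable {s : Node E}

lemma mem_T0 (hs : s.Valid M w ℓ i) {e : E} : e ∈ s.T0 ↔ e ∈ opt M w s.F.toFinset := by
  rw [← hs.toFinset_T0, List.mem_toFinset]

lemma card_F (hs : s.Valid M w ℓ i) : s.F.toFinset.card = i := by
  rw [List.toFinset_card_of_nodup hs.nodup_F, hs.length_F]

lemma mem_headD_Ts (hs : s.Valid M w ℓ i) (hi : i < ℓ) {x : E} :
    x ∈ s.Ts.headD [] ↔ x ∈ opt M w (s.F.toFinset ∪ opt M w s.F.toFinset) := by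
  have hne : s.Ts ≠ [] := by
    intro h
    have := hs.length_Ts
    simp [h] at this
    omega
  rw [← hs.layers.toFinset_headD hne, List.mem_toFinset]

lemma isReplacement_iff (hs : s.Valid M w ℓ i) (hi : i < ℓ) {e r : E} :
    IsReplacement M w s.T0 (s.Ts.headD []) e r ↔
      (r ∈ opt M w (s.F.toFinset ∪ opt M w s.F.toFinset) ∧
        M.Indep (insert r (opt M w s.F.toFinset \ {e} : Set E))) ∧
      ∀ r' ∈ opt M w (s.F.toFinset ∪ opt M w s.F.toFinset),
        M.Indep (insert r' (opt M w s.F.toFinset \ {e} : Set E)) → key w r ≤ key w r' := by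
  have hn : ∀ x ∈ opt M w (s.F.toFinset ∪ opt M w s.F.toFinset), x ∉ opt M w s.F.toFinset := by
    intro x hx hx'
    exact (mem_opt.1 hx).1 (Finset.mem_union_right _ hx')
  simp only [IsReplacement, hs.mem_headD_Ts hi, hs.mem_T0]
  constructor
  · exact fun h => ⟨⟨h.1.1, h.1.2.2⟩, fun r' h1 h2 => h.2 r' h1 (hn r' h1) h2⟩
  · exact fun h => ⟨⟨h.1.1, hn r h.1.1, h.1.2⟩, fun r' h1 _ h2 => h.2 r' h1 h2⟩

lemma opt_insert (hE : M.E = Set.univ) (hs : s.Valid M w ℓ i) (hi : i < ℓ) {e r : E}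
    (he : e ∈ s.T0) (hr : IsReplacement M w s.T0 (s.Ts.headD []) e r) :
    opt M w (insert e s.F.toFinset) = insert r ((opt M w s.F.toFinset).erase e) := by
  obtain ⟨⟨h1, h2⟩, h3⟩ := (hs.isReplacement_iff hi).1 hr
  exact opt_insert_of_indep hE (hs.mem_T0.1 he) h1 h2 h3

lemma notMem_opt_of_isReplacement (hs : s.Valid M w ℓ i) {e r : E}
    (hr : IsReplacement M w s.T0 (s.Ts.headD []) e r) : r ∉ opt M w s.F.toFinset :=
  fun h => hr.1.2.1 (hs.mem_T0.2 h)

lemma sum_opt_insert (hE : M.E = Set.univ) (hs : s.Valid M w ℓ i) (hi : i < ℓ) {e r : E}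
    (he : e ∈ s.T0) (hr : IsReplacement M w s.T0 (s.Ts.headD []) e r) :
    s.wT0 - w e + w r = ∑ x ∈ opt M w (insert e s.F.toFinset), w x := by
  have := Finset.sum_erase_add _ w (hs.mem_T0.1 he)
  rw [hs.opt_insert hE hi he hr, Finset.sum_insert
    (fun h => hs.notMem_opt_of_isReplacement hr (Finset.mem_of_mem_erase h)), hs.wT0_eq]
  linarith

lemma exists_isReplacement (hE : M.E = Set.univ)
    (hopt : ∀ G : Finset E, G.card ≤ ℓ → (opt M w G).card = rk M)
    (hs : s.Valid M w ℓ i) (hi : i < ℓ) {e : E} (he : e ∈ s.T0) :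
    ∃ r, IsReplacement M w s.T0 (s.Ts.headD []) e r := by
  classical
  have hc : (insert e s.F.toFinset).card ≤ ℓ := by
    have := Finset.card_insert_le e s.F.toFinset
    rw [hs.card_F] at this
    omega
  obtain ⟨r₀, hr₀, hi₀⟩ := exists_replacement hE (hs.mem_T0.1 he)
    (by rw [hopt _ hc]; exact card_opt_le hE _)
  obtain ⟨r, hr, hmin⟩ := Finset.exists_min_image
    ((opt M w (s.F.toFinset ∪ opt M w s.F.toFinset)).filter fun r =>
      M.Indep (insert r (opt M w s.F.toFinset \ {e} : Set E))) (key w)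
    ⟨r₀, Finset.mem_filter.2 ⟨hr₀, hi₀⟩⟩
  rw [Finset.mem_filter] at hr
  exact ⟨r, (hs.isReplacement_iff hi).2
    ⟨hr, fun r' h1 h2 => hmin r' (Finset.mem_filter.2 ⟨h1, h2⟩)⟩⟩

lemma notMem_F (hs : s.Valid M w ℓ i) {e : E} (he : e ∈ s.T0) : e ∉ s.F := fun h =>
  (mem_opt.1 (hs.mem_T0.1 he)).1 (List.mem_toFinset.2 h)

lemma child (hE : M.E = Set.univ) (hs : s.Valid M w ℓ i) (hi : i < ℓ) {forb : List E} {e r : E}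
    (he : e ∈ s.T0) (hr : IsReplacement M w s.T0 (s.Ts.headD []) e r) (hf : forb.Nodup)
    (hfs : forb ⊆ s.T0) (hef : e ∉ forb) :
    (MatroidInterdiction.child M w f s forb e r).val.Valid M w ℓ (i + 1) := by
  have hval : (MatroidInterdiction.child M w f s forb e r).val =
      ⟨e :: s.F, forb, s.wT0 - w e + w r, r :: s.T0.erase e, (shift M w f (some r) s.Ts).val⟩ := by
    simp [MatroidInterdiction.child, erase_val]
  have ho := hs.opt_insert hE hi he hr
  have hF : (e :: s.F).toFinset = insert e s.F.toFinset := List.toFinset_cons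
  rw [hval]
  refine ⟨List.nodup_cons.2 ⟨hs.notMem_F he, hs.nodup_F⟩, ?_, hf, ?_, ?_, ?_, ?_, ?_, ?_, ?_⟩
  · simp [hs.length_F]
  · intro x hx
    refine List.mem_cons_of_mem _ ((List.mem_erase_of_ne ?_).2 (hfs hx))
    rintro rfl
    exact hef hx
  · exact List.nodup_cons.2 ⟨fun h => hr.1.2.1 (List.mem_of_mem_erase h), hs.nodup_T0.erase e⟩
  · rw [hF, ho]
    ext x
    simp [hs.nodup_T0.mem_erase_iff, hs.mem_T0]
  · rw [hF]
    exact hs.sum_opt_insert hE hi he hr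
  -- Moving e from the basis to F(s) leaves the union unchanged, so only r is new, and the shift
  -- starts with r.
  · have : insert e s.F.toFinset ∪ opt M w (insert e s.F.toFinset) =
        insert r (s.F.toFinset ∪ opt M w s.F.toFinset) := by
      have := hs.mem_T0.1 he
      rw [ho]; ext u; simp only [Finset.mem_union, Finset.mem_insert, Finset.mem_erase]; grind
    rw [hF, this]
    exact hs.layers.shift_some hE ((hs.isReplacement_iff hi).1 hr).1.1
  · have := hs.length_Ts
    simp only [length_shift]
    omega
  · rw [hF]
    exact hs.isExhaustible.insert (hs.mem_T0.1 he)

lemma length_T0 (hopt : ∀ G : Finset E, G.card ≤ ℓ → (opt M w G).card = rk M)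
    (hs : s.Valid M w ℓ i) : s.T0.length = rk M := by
  rw [← List.toFinset_card_of_nodup hs.nodup_T0, hs.toFinset_T0, hopt]
  rw [hs.card_F]
  have := hs.length_Ts
  omega

end Node.Valid

omit [Fintype E] in
lemma root_val (es : List E) : (root M w f ℓ es).val =
    ⟨[], [], ((greedy M f (sort w es).val []).val.1.map w).sum, (greedy M f (sort w es).val []).val.1,
      (bases M f ℓ (greedy M f (sort w es).val []).val.2).val⟩ := by
  rw [← totalWeight_val]
  rfl

lemma valid_root (hE : M.E = Set.univ) {es : List E} (hes : es.Nodup) (hmem : ∀ e, e ∈ es) :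
    (root M w f ℓ es).val.Valid M w ℓ 0 ∧ (root M w f ℓ es).val.forb = [] := by
  have hperm := sort_perm (w := w) es
  have hnd : (sort w es).val.Nodup := hperm.nodup_iff.2 hes
  have hs : (sort w es).val.Pairwise fun x z => key w x < key w z :=
    ((keySorted_sort es).and hnd).imp fun h =>
      lt_of_le_of_ne h.1 fun h' => h.2 (key_injective w h')
  have hm : ∀ e, e ∈ (sort w es).val := fun e => hperm.mem_iff.2 (hmem e)
  have hg := greedy_val (M := M) (f := f) (A := ∅) (cur := []) hE hs (by simp) (by simp [hm])
  have hB : ((sort w es).val.filter (· ∈ opt M w ∅)).toFinset = opt M w ∅ := by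
    ext x; simp [hm]
  rw [root_val, hg]
  refine ⟨⟨List.nodup_nil, rfl, List.nodup_nil, List.nil_subset _, hnd.filter _, hB, ?_, ?_, ?_,
    isExhaustible_empty⟩, rfl⟩
  · have := List.sum_toFinset w (hnd.filter (· ∈ opt M w ∅))
    rw [hB] at this
    exact this.symm
  · refine layers_bases hE ℓ (hs.filter _) fun x => ?_
    simp [hm]
  · exact length_bases _ _

section Loop

variable {s : Node E} {ps : List (E × E)} {forb : List E}

omit [Fintype E] in
lemma childrenLoop_cons_val (e r : E) :
    (childrenLoop M w f s ((e, r) :: ps) forb).val =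
      if e ∈ forb then (childrenLoop M w f s ps forb).val
      else (child M w f s forb e r).val :: (childrenLoop M w f s ps (e :: forb)).val := by
  simp only [childrenLoop, bind_val]
  by_cases h : e ∈ forb
  · rw [if_pos h, if_pos ((member_val e forb).2 h)]
  · rw [if_neg h, if_neg (mt (member_val e forb).1 h)]
    rfl

lemma valid_of_mem_childrenLoop (hE : M.E = Set.univ) (hs : s.Valid M w ℓ i) (hi : i < ℓ)
    (hps : ∀ p ∈ ps, p.1 ∈ s.T0 ∧ IsReplacement M w s.T0 (s.Ts.headD []) p.1 p.2)
    (hf : forb.Nodup) (hfs : forb ⊆ s.T0) :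
    ∀ d ∈ (childrenLoop M w f s ps forb).val, d.Valid M w ℓ (i + 1) := by
  induction ps generalizing forb with
  | nil => simp [childrenLoop]
  | cons p ps ih =>
    obtain ⟨e, r⟩ := p
    simp only [List.mem_cons, forall_eq_or_imp] at hps
    obtain ⟨⟨he, hr⟩, hps⟩ := hps
    rw [childrenLoop_cons_val]
    split
    · exact ih hps hf hfs
    · rename_i hef
      simp only [List.mem_cons, forall_eq_or_imp]
      exact ⟨hs.child hE hi he hr hf hfs hef,
        ih hps (List.nodup_cons.2 ⟨hef, hf⟩) (List.cons_subset.2 ⟨he, hfs⟩)⟩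

omit [Fintype E] in
/-- The number of descendants of the children, `n` levels further down. -/
lemma sum_multichoose_childrenLoop {k : ℕ} (n : ℕ) (hT0 : s.T0.Nodup) (hk : s.T0.length = k)
    (hps : ∀ p ∈ ps, p.1 ∈ s.T0) (hf : forb.Nodup) (hfs : forb ⊆ s.T0)
    (hcov : ∀ x ∈ s.T0, x ∈ forb ∨ x ∈ ps.map Prod.fst) :
    ((childrenLoop M w f s ps forb).val.map fun d => (k - d.forb.length).multichoose n).sum =
      (k - forb.length).multichoose (n + 1) := by
  induction ps generalizing forb with
  | nil =>
    have : s.T0.length ≤ forb.length :=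
      (List.subperm_of_subset hT0 fun x hx => by simpa using hcov x hx).length_le
    -- At the end of the list all of `s.T0` is forbidden.
    have h0 : k - forb.length = 0 := by omega
    simp [childrenLoop, h0, Nat.multichoose_zero_succ]
  | cons p ps ih =>
    obtain ⟨e, r⟩ := p
    simp only [List.mem_cons, forall_eq_or_imp] at hps
    rw [childrenLoop_cons_val]
    split
    · rename_i hef
      refine ih hps.2 hf hfs fun x hx => ?_
      rcases hcov x hx with h | h
      · exact Or.inl h
      · rcases List.mem_cons.1 h with rfl | h
        · exact Or.inl hef
        · exact Or.inr h
    · rename_i hef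
      have hf' : (e :: forb).Nodup := List.nodup_cons.2 ⟨hef, hf⟩
      have hfs' : e :: forb ⊆ s.T0 := List.cons_subset.2 ⟨hps.1, hfs⟩
      have hlen := (List.subperm_of_subset hf' hfs').length_le
      rw [List.length_cons] at hlen
      have hd : (child M w f s forb e r).val.forb = forb := rfl
      rw [List.map_cons, List.sum_cons, hd, ih hps.2 hf' hfs' fun x hx => ?_]
      -- The child counts for c + 1 free elements and the remaining loop for c: the Pascal rule for
      -- `Nat.multichoose`.
      · obtain ⟨c, hc⟩ : ∃ c, k - forb.length = c + 1 := ⟨k - forb.length - 1, by omega⟩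
        have hc' : k - (e :: forb).length = c := by rw [List.length_cons]; omega
        rw [hc, hc', Nat.multichoose_succ_succ, add_comm]
      · rcases hcov x hx with h | h
        · exact Or.inl (List.mem_cons_of_mem _ h)
        · rcases List.mem_cons.1 h with rfl | h
          · exact Or.inl List.mem_cons_self
          · exact Or.inr h

-- The child at the first listed element of G works: everything newly forbidden before it lies
-- outside G.
omit [Fintype E] in
lemma exists_mem_childrenLoop {G : Finset E} (hF : ∀ x ∈ s.F, x ∈ G) (hG : ∀ x ∈ forb, x ∉ G)
    (hex : ∃ x ∈ G, x ∈ ps.map Prod.fst) :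
    ∃ d ∈ (childrenLoop M w f s ps forb).val, (∀ x ∈ d.F, x ∈ G) ∧ ∀ x ∈ d.forb, x ∉ G := by
  induction ps generalizing forb with
  | nil => simp at hex
  | cons p ps ih =>
    obtain ⟨e, r⟩ := p
    obtain ⟨x, hx, hxp⟩ := hex
    rw [childrenLoop_cons_val]
    split
    · rename_i hef
      refine ih hG ⟨x, hx, (List.mem_cons.1 hxp).resolve_left ?_⟩
      rintro rfl
      exact hG _ hef hx
    · by_cases heG : e ∈ G
      · refine ⟨_, List.mem_cons_self, ?_, hG⟩
        intro u hu
        rcases List.mem_cons.1 hu with rfl | hu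
        · exact heG
        · exact hF u hu
      · obtain ⟨d, hd, h⟩ := ih (forb := e :: forb)
          (by simpa only [List.mem_cons, forall_eq_or_imp] using ⟨heG, hG⟩)
          ⟨x, hx, (List.mem_cons.1 hxp).resolve_left (by rintro rfl; exact heG hx)⟩
        exact ⟨d, List.mem_cons_of_mem _ hd, h⟩

end Loop

omit [Fintype E] in
lemma nextLevel_cons_val (s : Node E) (N : List (Node E)) : (nextLevel M w f H (s :: N)).val =
    (children M w f H s).val ++ (nextLevel M w f H N).val := by
  simp [nextLevel, append_val]

omit [Fintype E] in
lemma mem_nextLevel {N : List (Node E)} {d : Node E} :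
    d ∈ (nextLevel M w f H N).val ↔ ∃ s ∈ N, d ∈ (children M w f H s).val := by
  induction N with
  | nil => simp [nextLevel]
  | cons s N ih => simp [nextLevel_cons_val, ih]

omit [Fintype E] [LinearOrder E] in
lemma outputLoop_val (s : Node E) (ps : List (E × E)) : (outputLoop w s ps).val =
    ps.map fun p => (p.1 :: s.F, s.wT0 - w p.1 + w p.2) := by
  induction ps with
  | nil => rfl
  | cons p ps ih => simp [outputLoop, ih]

omit [Fintype E] in
lemma output_cons_val (s : Node E) (N : List (Node E)) : (output M w H (s :: N)).val =
    ((replacements M w H s.T0 (s.Ts.headD [])).val.map fun p =>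
      (p.1 :: s.F, s.wT0 - w p.1 + w p.2)) ++ (output M w H N).val := by
  simp [output, append_val, outputLoop_val]

omit [Fintype E] in
lemma mem_output {N : List (Node E)} {q : List E × ℝ} :
    q ∈ (output M w H N).val ↔
      ∃ s ∈ N, ∃ p ∈ (replacements M w H s.T0 (s.Ts.headD [])).val,
        q = (p.1 :: s.F, s.wT0 - w p.1 + w p.2) := by
  induction N with
  | nil => simp [output]
  | cons s N ih => simp [output_cons_val, ih, eq_comm]

/-- The list of the nodes of level `i` is correct. -/
structure LevelValid (M : Matroid E) (w : E → ℝ) (ℓ i : ℕ) (N : List (Node E)) : Prop where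
  valid : ∀ s ∈ N, s.Valid M w ℓ i
  sum_multichoose : ∀ n,
    (N.map fun s => (rk M - s.forb.length).multichoose n).sum = (rk M).multichoose (i + n)
  complete : ∀ G : Finset E, G.card = ℓ → IsExhaustible M w G →
    ∃ s ∈ N, (∀ x ∈ s.F, x ∈ G) ∧ ∀ x ∈ s.forb, x ∉ G

lemma LevelValid.length_eq {N : List (Node E)} (hN : LevelValid M w ℓ i N) :
    N.length = (rk M).multichoose i := by
  simpa using hN.sum_multichoose 0

lemma Node.Valid.exists_mem_T0 {s : Node E} (hs : s.Valid M w ℓ i) (hi : i < ℓ) {G : Finset E}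
    (hG : G.card = ℓ) (hex : IsExhaustible M w G) (hF : ∀ x ∈ s.F, x ∈ G) : ∃ x ∈ G, x ∈ s.T0 := by
  obtain ⟨x, hx, hxo⟩ := hex s.F.toFinset (Finset.ssubset_iff_subset_ne.2
    ⟨fun x hx => hF x (List.mem_toFinset.1 hx), fun h => by
      have := hs.card_F
      rw [h, hG] at this
      omega⟩)
  exact ⟨x, hx, hs.mem_T0.2 hxo⟩

lemma levelValid_root (hE : M.E = Set.univ) {es : List E} (hes : es.Nodup) (hmem : ∀ e, e ∈ es) :
    LevelValid M w ℓ 0 [(root M w f ℓ es).val] := by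
  obtain ⟨h1, h2⟩ := valid_root (M := M) (w := w) (f := f) (ℓ := ℓ) hE hes hmem
  refine ⟨by simpa using h1, by simp [h2], fun G _ _ => ⟨_, List.mem_singleton_self _, ?_, ?_⟩⟩
  · rw [root_val]; simp
  · simp [h2]

lemma LevelValid.map_fst_replacements (hE : M.E = Set.univ)
    (hopt : ∀ G : Finset E, G.card ≤ ℓ → (opt M w G).card = rk M) {N : List (Node E)}
    (hN : LevelValid M w ℓ i N)
    (hi : i < ℓ) {s : Node E} (hs : s ∈ N) :
    (replacements M w H s.T0 (s.Ts.headD [])).val.map Prod.fst = s.T0 :=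
  MatroidInterdiction.map_fst_replacements
    fun _ he => (hN.valid s hs).exists_isReplacement hE hopt hi he

lemma LevelValid.nextLevel (hE : M.E = Set.univ)
    (hopt : ∀ G : Finset E, G.card ≤ ℓ → (opt M w G).card = rk M) {N : List (Node E)}
    (hN : LevelValid M w ℓ i N) (hi : i < ℓ) :
    LevelValid M w ℓ (i + 1) (nextLevel M w f H N).val := by
  have hmap := fun s (hs : s ∈ N) => hN.map_fst_replacements (H := H) hE hopt hi hs
  refine ⟨fun d hd => ?_, fun n => ?_, fun G hG hex => ?_⟩
  · obtain ⟨s, hs, hd⟩ := mem_nextLevel.1 hd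
    have hv := hN.valid s hs
    exact valid_of_mem_childrenLoop hE hv hi (fun p hp => isReplacement_of_mem_replacements hp)
      hv.nodup_forb hv.forb_subset d hd
  · rw [show i + 1 + n = i + (n + 1) by omega, ← hN.sum_multichoose (n + 1)]
    have : ∀ s ∈ N, ((children M w f H s).val.map fun d =>
        (rk M - d.forb.length).multichoose n).sum = (rk M - s.forb.length).multichoose (n + 1) := by
      intro s hs
      have hv := hN.valid s hs
      refine sum_multichoose_childrenLoop n hv.nodup_T0 (hv.length_T0 hopt)
        (fun p hp => (isReplacement_of_mem_replacements hp).1) hv.nodup_forb hv.forb_subset ?_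
      intro x hx
      rw [hmap s hs]
      exact Or.inr hx
    clear hmap hN
    induction N with
    | nil => simp [MatroidInterdiction.nextLevel]
    | cons s N ih =>
      simp only [List.mem_cons, forall_eq_or_imp] at this
      rw [nextLevel_cons_val, List.map_append, List.sum_append, this.1, ih this.2, List.map_cons,
        List.sum_cons]
  · obtain ⟨s, hs, hF, hforb⟩ := hN.complete G hG hex
    obtain ⟨x, hx, hxT⟩ := (hN.valid s hs).exists_mem_T0 hi hG hex hF
    obtain ⟨d, hd, h⟩ := exists_mem_childrenLoop (M := M) (w := w) (f := f) hF hforb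
      ⟨x, hx, (hmap s hs).symm ▸ hxT⟩
    exact ⟨d, mem_nextLevel.2 ⟨s, hs, hd⟩, h⟩

lemma LevelValid.levels (hE : M.E = Set.univ)
    (hopt : ∀ G : Finset E, G.card ≤ ℓ → (opt M w G).card = rk M) {n : ℕ} {N : List (Node E)}
    (hN : LevelValid M w ℓ i N) (hi : i + n ≤ ℓ) :
    LevelValid M w ℓ (i + n) (levels M w f H n N).val := by
  induction n generalizing i N with
  | zero => exact hN
  | succ n ih =>
    have := ih (hN.nextLevel (f := f) (H := H) hE hopt (by omega)) (by omega)
    rwa [show i + 1 + n = i + (n + 1) by omega] at this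

section Output

variable {N : List (Node E)}

/-- Forbidden elements are not skipped at the last level, so every node yields a full basis of
candidates. -/
lemma LevelValid.length_output (hE : M.E = Set.univ)
    (hopt : ∀ G : Finset E, G.card ≤ ℓ → (opt M w G).card = rk M) (hN : LevelValid M w ℓ i N)
    (hi : i < ℓ) : (output M w H N).val.length = N.length * rk M := by
  have : ∀ s ∈ N, (replacements M w H s.T0 (s.Ts.headD [])).val.length = rk M := by
    intro s hs
    rw [← (hN.valid s hs).length_T0 hopt, ← hN.map_fst_replacements (H := H) hE hopt hi hs,
      List.length_map, hN.map_fst_replacements hE hopt hi hs]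
  clear hN
  induction N with
  | nil => simp [output]
  | cons s N ih =>
    simp only [List.mem_cons, forall_eq_or_imp] at this
    rw [output_cons_val, List.length_append, List.length_map, this.1, ih this.2, List.length_cons]
    ring

lemma LevelValid.correct_of_mem_output (hE : M.E = Set.univ)
    (hopt : ∀ G : Finset E, G.card ≤ i + 1 → (opt M w G).card = rk M)
    (hN : LevelValid M w (i + 1) i N) {q : List E × ℝ} (hq : q ∈ (output M w H N).val) :
    q.1.Nodup ∧ q.1.length = i + 1 ∧ (q.2 : EReal) = y M w q.1.toFinset := by
  obtain ⟨s, hs, p, hp, rfl⟩ := mem_output.1 hq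
  obtain ⟨he, hr⟩ := isReplacement_of_mem_replacements hp
  have hv := hN.valid s hs
  have hnd : (p.1 :: s.F).Nodup := List.nodup_cons.2 ⟨hv.notMem_F he, hv.nodup_F⟩
  have hlen : (p.1 :: s.F).length = i + 1 := by rw [List.length_cons, hv.length_F]
  refine ⟨hnd, hlen, ?_⟩
  rw [y_eq hE (hopt _ (by rw [List.toFinset_card_of_nodup hnd, hlen])), List.toFinset_cons]
  exact congrArg _ (hv.sum_opt_insert hE (Nat.lt_succ_self i) he hr)

lemma LevelValid.mem_candidates_iff (hE : M.E = Set.univ)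
    (hopt : ∀ G : Finset E, G.card ≤ i + 1 → (opt M w G).card = rk M)
    (hN : LevelValid M w (i + 1) i N) {G : Finset E} :
    G ∈ candidates (output M w H N).val ↔ IsRelevant M w (i + 1) G := by
  rw [isRelevant_iff hE]
  constructor
  · rintro ⟨q, hq, rfl⟩
    obtain ⟨h1, h2, -⟩ := hN.correct_of_mem_output hE hopt hq
    refine ⟨by rw [List.toFinset_card_of_nodup h1, h2], ?_⟩
    obtain ⟨s, hs, p, hp, rfl⟩ := mem_output.1 hq
    have hv := hN.valid s hs
    rw [List.toFinset_cons]
    exact hv.isExhaustible.insert (hv.mem_T0.1 (isReplacement_of_mem_replacements hp).1)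
  · rintro ⟨hG, hex⟩
    obtain ⟨s, hs, hF, -⟩ := hN.complete G hG hex
    have hv := hN.valid s hs
    obtain ⟨x, hx, hxT⟩ := hv.exists_mem_T0 (Nat.lt_succ_self i) hG hex hF
    have hxm : x ∈ (replacements M w H s.T0 (s.Ts.headD [])).val.map Prod.fst :=
      (hN.map_fst_replacements hE hopt (Nat.lt_succ_self i) hs).symm ▸ hxT
    obtain ⟨p, hp, rfl⟩ := List.mem_map.1 hxm
    refine ⟨_, mem_output.2 ⟨s, hs, p, hp, rfl⟩, Finset.eq_of_subset_of_card_le ?_ ?_⟩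
    · intro u hu
      rcases List.mem_cons.1 (List.mem_toFinset.1 hu) with rfl | hu
      · exact hx
      · exact hF u hu
    · rw [hG, List.toFinset_cons, Finset.card_insert_of_notMem
        (fun h => hv.notMem_F hxT (List.mem_toFinset.1 h)), hv.card_F]

end Output

end Nodes

/-! ### Running time. -/

section Time

variable {E : Type} [Fintype E] [LinearOrder E] {M : Matroid E} {w : E → ℝ} {f H ℓ i k : ℕ}

/-- A bound for the number of steps that the computation of a child takes. -/
def childCost (k ℓ f : ℕ) : ℕ := ℓ * (k * (f + 1) + k + 3) + k + 3

omit [Fintype E] in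
lemma child_time_le {s : Node E} (forb : List E) (e r : E) (hT0 : s.T0.length ≤ k)
    (hTs : s.Ts.length ≤ ℓ) (hT : ∀ T ∈ s.Ts, T.length ≤ k) :
    (child M w f s forb e r).time ≤ childCost k ℓ f := by
  have h1 := erase_time_le e s.T0
  have h2 := shift_time_le (M := M) (w := w) (f := f) (some r) hT
  have h3 : s.Ts.length * (k * (f + 1) + k + 3) ≤ ℓ * (k * (f + 1) + k + 3) :=
    Nat.mul_le_mul_right _ hTs
  simp only [child, bind_time, tick_time, pure_time, childCost]
  omega

omit [Fintype E] in
lemma childrenLoop_time_le {s : Node E} {ps : List (E × E)} {forb : List E}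
    (hT0 : s.T0.length ≤ k) (hTs : s.Ts.length ≤ ℓ) (hT : ∀ T ∈ s.Ts, T.length ≤ k)
    (hps : ∀ p ∈ ps, p.1 ∈ s.T0) (hf : forb.Nodup) (hfs : forb ⊆ s.T0) :
    (childrenLoop M w f s ps forb).time ≤
      ps.length * (k + 2) + (childrenLoop M w f s ps forb).val.length * childCost k ℓ f + 1 := by
  induction ps generalizing forb with
  | nil => simp [childrenLoop]
  | cons p ps ih =>
    obtain ⟨e, r⟩ := p
    simp only [List.mem_cons, forall_eq_or_imp] at hps
    have hlen := (List.subperm_of_subset hf hfs).length_le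
    have h1 := member_time_le e forb
    have h2 := child_time_le (M := M) (w := w) (f := f) forb e r hT0 hTs hT
    rw [childrenLoop_cons_val, List.length_cons, Nat.succ_mul]
    simp only [childrenLoop, bind_time, tick_time]
    by_cases hef : e ∈ forb
    · have h3 := ih hps.2 hf hfs
      rw [if_pos hef, if_pos ((member_val e forb).2 hef)]
      omega
    · have h3 := ih hps.2 (List.nodup_cons.2 ⟨hef, hf⟩) (List.cons_subset.2 ⟨hps.1, hfs⟩)
      rw [if_neg hef, if_neg (mt (member_val e forb).1 hef), List.length_cons, Nat.succ_mul]
      simp only [bind_time, pure_time]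
      omega

lemma Node.Valid.children_time_le (hE : M.E = Set.univ)
    (hopt : ∀ G : Finset E, G.card ≤ ℓ → (opt M w G).card = rk M) {s : Node E}
    (hs : s.Valid M w ℓ i) : (children M w f H s).time ≤
      H + rk M * (rk M + 2) + (children M w f H s).val.length * childCost (rk M) ℓ f + 2 := by
  have hT0 := hs.length_T0 hopt
  have h := childrenLoop_time_le (M := M) (w := w) (f := f)
    (ps := (replacements M w H s.T0 (s.Ts.headD [])).val) hT0.le
    (show s.Ts.length ≤ ℓ by have := hs.length_Ts; omega) (hs.layers.length_le hE)
    (fun p hp => (isReplacement_of_mem_replacements hp).1) hs.nodup_forb hs.forb_subset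
  have h1 : (replacements M w H s.T0 (s.Ts.headD [])).val.length * (rk M + 2) ≤
      rk M * (rk M + 2) :=
    Nat.mul_le_mul_right _ ((List.length_filterMap_le _ _).trans hT0.le)
  simp only [children, bind_time, bind_val, tick_time, replacements_time] at *
  omega

lemma LevelValid.nextLevel_time_le (hE : M.E = Set.univ)
    (hopt : ∀ G : Finset E, G.card ≤ ℓ → (opt M w G).card = rk M) {N : List (Node E)}
    (hN : ∀ s ∈ N, s.Valid M w ℓ i) : (MatroidInterdiction.nextLevel M w f H N).time ≤
      N.length * (H + rk M * (rk M + 2) + 4) +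
        (MatroidInterdiction.nextLevel M w f H N).val.length * (childCost (rk M) ℓ f + 1) + 1 := by
  induction N with
  | nil => simp [MatroidInterdiction.nextLevel]
  | cons s N ih =>
    simp only [List.mem_cons, forall_eq_or_imp] at hN
    have h1 := hN.1.children_time_le (f := f) (H := H) hE hopt
    have h2 := ih hN.2
    rw [nextLevel_cons_val, List.length_cons, Nat.succ_mul, List.length_append, Nat.add_mul]
    simp only [MatroidInterdiction.nextLevel, bind_time, tick_time, append_time]
    rw [Nat.mul_succ ((children M w f H s).val.length)]
    omega

/-- The cost of scanning a basis is charged to the expanded node, that of building a node to the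
node itself. Hence the two sums, shifted by one level. -/
lemma LevelValid.levels_time_le (hE : M.E = Set.univ) (hk : 0 < rk M)
    (hopt : ∀ G : Finset E, G.card ≤ ℓ → (opt M w G).card = rk M) {n : ℕ} {N : List (Node E)}
    (hN : LevelValid M w ℓ i N) (hi : i + n ≤ ℓ) : (MatroidInterdiction.levels M w f H n N).time ≤
      (∑ j ∈ Finset.range n, (rk M).multichoose (i + j)) * (H + rk M * (rk M + 2) + 6) +
        (∑ j ∈ Finset.range n, (rk M).multichoose (i + j + 1)) * (childCost (rk M) ℓ f + 1) + 1 := by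
  induction n generalizing i N with
  | zero => simp [MatroidInterdiction.levels]
  | succ n ih =>
    have hN' := hN.nextLevel (f := f) (H := H) hE hopt (by omega)
    have h1 := LevelValid.nextLevel_time_le (f := f) (H := H) hE hopt hN.valid
    have h2 := ih hN' (by omega)
    -- A level is non-empty, so its constant overhead is absorbed by raising the 4 per node to 6.
    have hpos : 1 ≤ (rk M).multichoose i := by
      rw [Nat.multichoose_eq]
      exact Nat.choose_pos (by omega)
    rw [hN.length_eq, hN'.length_eq] at h1
    rw [Finset.sum_range_succ', Finset.sum_range_succ']
    have hshift : ∀ g : ℕ → ℕ, ∑ j ∈ Finset.range n, g (i + (j + 1)) =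
        ∑ j ∈ Finset.range n, g (i + 1 + j) := fun g =>
      Finset.sum_congr rfl fun j _ => by rw [add_assoc, add_comm 1 j]
    rw [hshift fun j => (rk M).multichoose j, hshift fun j => (rk M).multichoose (j + 1)]
    simp only [MatroidInterdiction.levels, bind_time, tick_time, add_zero]
    have h3 : (rk M).multichoose i * (H + rk M * (rk M + 2) + 6) =
      (rk M).multichoose i * (H + rk M * (rk M + 2) + 4) + 2 * (rk M).multichoose i := by ring
    rw [Nat.add_mul (∑ j ∈ Finset.range n, _), Nat.add_mul (∑ j ∈ Finset.range n, _)]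
    omega

lemma LevelValid.output_time_le
    (hopt : ∀ G : Finset E, G.card ≤ ℓ → (opt M w G).card = rk M) {N : List (Node E)}
    (hN : ∀ s ∈ N, s.Valid M w ℓ i) :
    (output M w H N).time ≤ N.length * (H + 2 * rk M + 3) + 1 := by
  induction N with
  | nil => simp [output]
  | cons s N ih =>
    simp only [List.mem_cons, forall_eq_or_imp] at hN
    have h2 := ih hN.2
    have h1 : (replacements M w H s.T0 (s.Ts.headD [])).val.length ≤ rk M :=
      (List.length_filterMap_le _ _).trans (hN.1.length_T0 hopt).le
    have h3 : ∀ ps : List (E × E), (outputLoop w s ps).time = ps.length + 1 := by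
      intro ps
      induction ps with
      | nil => rfl
      | cons p ps ih => simp [outputLoop, ih]; omega
    rw [List.length_cons, Nat.succ_mul]
    simp only [output, bind_time, tick_time, append_time, replacements_time, h3, outputLoop_val,
      List.length_map]
    omega

lemma root_time_le (hE : M.E = Set.univ) {es : List E} (hes : es.Nodup) (hmem : ∀ e, e ∈ es)
    {r : ℕ} (hr : es.length ≤ 2 ^ r) : (root M w f ℓ es).time ≤
      r * (2 * es.length + 2) + (ℓ + 1) * (es.length * (f + 1) + 2) + 3 * es.length + 6 := by
  have hv := (valid_root (M := M) (w := w) (f := f) (ℓ := ℓ) hE hes hmem).1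
  have hlen : (sort w es).val.length = es.length := (sort_perm es).length_eq
  have h1 := sort_time_le (w := w) hr
  have h2 := greedy_time_le (M := M) (f := f) (sort w es).val []
  have h3 := bases_time_le (M := M) (f := f) ℓ (greedy M f (sort w es).val []).val.2
  have h4 : (greedy M f (sort w es).val []).val.2.length ≤ es.length :=
    hlen ▸ length_greedy_snd_le _ _
  have h5 : ℓ * ((greedy M f (sort w es).val []).val.2.length * (f + 1) + 2) ≤
      ℓ * (es.length * (f + 1) + 2) := by gcongr
  have h6 : (greedy M f (sort w es).val []).val.1.length ≤ es.length := by
    have := hv.nodup_T0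
    rw [root_val] at this
    exact (List.subperm_of_subset this fun x _ => hmem x).length_le
  rw [hlen] at h2
  simp only [root, bind_time, tick_time, pure_time, totalWeight_time]
  rw [Nat.succ_mul ℓ]
  omega

lemma sum_range_multichoose (k n : ℕ) :
    ∑ j ∈ Finset.range (n + 1), k.multichoose j = (k + 1).multichoose n := by
  induction n with
  | zero => simp
  | succ n ih => rw [Finset.sum_range_succ, ih, Nat.multichoose_succ_succ, add_comm]

lemma multichoose_succ_le_pow (k n : ℕ) : (k + 1).multichoose n ≤ (k + n) ^ n := by
  rw [Nat.multichoose_eq, show k + 1 + n - 1 = k + n by omega]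
  exact Nat.choose_le_pow _ _

/-- The final 3 collects the call of the algorithm and the additive constants of the two bounds for
descending and for output. -/
lemma tree_cost_le {k f : ℕ} (H n : ℕ) (hk : 0 < k) (hf : 1 ≤ f) :
    (∑ j ∈ Finset.range n, k.multichoose j) * (H + k * (k + 2) + 6) +
        (∑ j ∈ Finset.range n, k.multichoose (j + 1)) * (childCost k (n + 1) f + 1) +
        k.multichoose n * (H + 2 * k + 3) + 3 ≤
      28 * ((k + (n + 1)) ^ n * (H + k * (n + 1) * f)) := by
  have hle : ∀ j : ℕ, j ≤ n → (k + j) ^ j ≤ (k + (n + 1)) ^ j := fun j hj =>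
    Nat.pow_le_pow_left (by omega) j
  have hS : ∑ j ∈ Finset.range n, k.multichoose j + k.multichoose n ≤ (k + (n + 1)) ^ n := by
    rw [← Finset.sum_range_succ, sum_range_multichoose]
    exact (multichoose_succ_le_pow k n).trans (hle n le_rfl)
  have hS2 : ∑ j ∈ Finset.range n, k.multichoose (j + 1) ≤ (k + (n + 1)) ^ n := by
    refine le_trans ?_ hS
    rw [← Finset.sum_range_succ, Finset.sum_range_succ']
    exact Nat.le_add_right _ _
  -- The membership tests cost k² per expanded node. Only levels below n are expanded, and their
  -- total is one power smaller, which pays for one factor k.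
  have hSk : (∑ j ∈ Finset.range n, k.multichoose j) * k ≤ (k + (n + 1)) ^ n := by
    cases n with
    | zero => simp
    | succ n =>
      rw [sum_range_multichoose, pow_succ]
      exact Nat.mul_le_mul ((multichoose_succ_le_pow k n).trans (hle n (Nat.le_succ n))) (by omega)
  set P := (k + (n + 1)) ^ n
  set S := ∑ j ∈ Finset.range n, k.multichoose j
  set S2 := ∑ j ∈ Finset.range n, k.multichoose (j + 1)
  set Q := k.multichoose n
  have hP : 1 ≤ P := Nat.one_le_pow _ _ (by omega)
  have hkf : 1 ≤ k * f := Nat.mul_pos hk hf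
  have hkX : k ≤ k * (n + 1) * f := by nlinarith
  have hX : childCost k (n + 1) f + 1 ≤ 11 * (k * (n + 1) * f) := by
    have h1 : k * (n + 1) ≤ k * (n + 1) * f := Nat.le_mul_of_pos_right _ hf
    have h2 : n + 1 ≤ k * (n + 1) := Nat.le_mul_of_pos_left _ hk
    unfold childCost
    nlinarith
  set X := k * (n + 1) * f
  have e1 : S2 * (childCost k (n + 1) f + 1) ≤ P * (11 * X) := Nat.mul_le_mul hS2 hX
  have e2 : (S + Q) * H ≤ P * H := Nat.mul_le_mul_right _ hS
  have e3 : S * k * k ≤ P * X := Nat.mul_le_mul hSk hkX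
  have e4 : Q * k ≤ P * X := Nat.mul_le_mul (le_trans (Nat.le_add_left _ _) hS) hkX
  have e5 : P ≤ P * X := Nat.le_mul_of_pos_right _ (by omega)
  nlinarith

lemma root_cost_le {m ℓ f : ℕ} (hm : 0 < m) (hℓ : 0 < ℓ) (hf : 1 ≤ f) :
    (((Nat.log 2 m + 1) * (2 * m + 2) + (ℓ + 1) * (m * (f + 1) + 2) + 3 * m + 6 : ℕ) : ℝ) ≤
      28 * (m * (Real.log m + ℓ * f)) := by
  have hm' : (1 : ℝ) ≤ m := by exact_mod_cast hm
  -- The factor 2 suffices because log 2 > 1/2.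
  have hlog : (Nat.log 2 m : ℝ) ≤ 2 * Real.log m := by
    have h1 : ((2 ^ Nat.log 2 m : ℕ) : ℝ) ≤ m := by
      exact_mod_cast Nat.pow_log_le_self 2 hm.ne'
    have h2 := Real.log_le_log (by positivity) h1
    rw [Nat.cast_pow, Real.log_pow] at h2
    have h3 := Real.log_two_gt_d9
    push_cast at h2
    have h4 : (0 : ℝ) ≤ Nat.log 2 m := Nat.cast_nonneg _
    nlinarith
  -- Lower order terms go into m ℓ f, because log m vanishes for m = 1.
  have hnat : (2 * m + 2) + (ℓ + 1) * (m * (f + 1) + 2) + 3 * m + 6 ≤ 28 * (m * (ℓ * f)) := by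
    have h1 : 1 ≤ ℓ * f := Nat.mul_pos hℓ hf
    have h2 : m ≤ m * (ℓ * f) := Nat.le_mul_of_pos_right _ h1
    have h3 : m * f ≤ m * (ℓ * f) := Nat.mul_le_mul_left _ (Nat.le_mul_of_pos_left _ hℓ)
    have h4 : m * ℓ ≤ m * (ℓ * f) := Nat.mul_le_mul_left _ (Nat.le_mul_of_pos_right _ hf)
    have h5 : ℓ ≤ m * ℓ := Nat.le_mul_of_pos_left _ hm
    nlinarith
  have hnat' : (((2 * m + 2) + (ℓ + 1) * (m * (f + 1) + 2) + 3 * m + 6 : ℕ) : ℝ) ≤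
      28 * (m * (ℓ * f)) := by exact_mod_cast hnat
  have h5 : (Nat.log 2 m : ℝ) * (2 * m + 2) ≤ (2 * Real.log m) * (4 * m) := by
    have := Real.log_nonneg hm'
    gcongr
    linarith
  have h6 : 0 ≤ Real.log m * m := mul_nonneg (Real.log_nonneg hm') (by positivity)
  push_cast at hnat' ⊢
  nlinarith

end Time

end MatroidInterdiction

/-! ### The main theorem. -/

open MatroidInterdiction
theorem mainTheorem10 :
    ∃ C : ℝ, ∀ (f H : ℕ → ℕ), (∀ n, 1 ≤ f n) →
      ∀ (E : Type) [Fintype E] [LinearOrder E] (M : Matroid E) (a b : E → ℝ) (lam : ℝ)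
        (m k ℓ : ℕ) (es : List E),
        M.E = Set.univ → m = Fintype.card E → k = rk M → 0 < k → 0 < ℓ → ℓ ≤ m →
        (∀ F : Finset E, F.card = ℓ →
          ∃ B : Finset E, (M.delete (F : Set E)).IsBase (B : Set E) ∧ B.card = k) →
        es.Nodup → (∀ e : E, e ∈ es) →
        let out := computeCandidates M (weight a b lam) ℓ (f m) (H m) es
        out.val.length = k * (k + ℓ - 2).choose (ℓ - 1) ∧
        (∀ p ∈ out.val, p.1.Nodup ∧ p.1.length = ℓ ∧
          (p.2 : EReal) = y M (weight a b lam) p.1.toFinset) ∧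
        (∀ F : Finset E, F ∈ candidates out.val ↔ IsRelevant M (weight a b lam) ℓ F) ∧
        (∃ F ∈ candidates out.val, IsMostVital M (weight a b lam) ℓ F) ∧
        ((∀ G : Finset E, G.card < ℓ → ∃! B : Finset E, IsMinWeightBasis M (weight a b lam) G B) →
          ∀ F : Finset E, IsMostVital M (weight a b lam) ℓ F → F ∈ candidates out.val) ∧
        (∀ J : Set ℝ, J.OrdConnected → lam ∈ J →
          (∀ μ ∈ J, Function.Injective (weight a b μ)) →
          ∀ F : Finset E, F.card = ℓ → ∃ F' ∈ candidates out.val,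
            ∀ μ ∈ J, y M (weight a b μ) F ≤ y M (weight a b μ) F') ∧
        (out.time : ℝ) ≤ C * (((k : ℝ) + ℓ) ^ (ℓ - 1) * (H m + k * ℓ * f m) +
          m * (Real.log m + ℓ * f m)) := by

  refine ⟨28, fun f H hf E _ _ M a b lam m k ℓ es hE hm hk hkpos hℓpos hℓm hrank hes hmem => ?_⟩
  subst hk hm
  -- The last level of the tree is i = ℓ - 1.
  obtain ⟨i, rfl⟩ : ∃ i, ℓ = i + 1 := ⟨ℓ - 1, by omega⟩
  intro out
  set w := weight a b lam
  have hopt : ∀ (w : E → ℝ) (G : Finset E), G.card ≤ i + 1 → (opt M w G).card = rk M :=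
    fun w G hG => card_opt_eq hE hℓm hrank hG
  have hne : ∀ (w : E → ℝ) (G : Finset E), G.card < i + 1 → (opt M w G).Nonempty :=
    fun w G hG => Finset.card_pos.1 (by rw [hopt w G hG.le]; exact hkpos)
  have hroot := levelValid_root (M := M) (w := w) (f := f (Fintype.card E)) (ℓ := i + 1) hE hes hmem
  have hlast := hroot.levels (f := f (Fintype.card E)) (H := H (Fintype.card E)) (n := i) hE (hopt w)
    (by omega)
  rw [zero_add] at hlast
  have hmemc : ∀ F : Finset E, F ∈ candidates out.val ↔ IsRelevant M w (i + 1) F :=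
    fun F => hlast.mem_candidates_iff hE (hopt w)
  have hlen : es.length = Fintype.card E := by
    rw [← List.toFinset_card_of_nodup hes, ← Finset.card_univ]
    congr 1
    ext e
    simp [hmem]
  refine ⟨?_, fun p hp => hlast.correct_of_mem_output hE (hopt w) hp, hmemc, ?_, ?_, ?_, ?_⟩
  · refine (hlast.length_output hE (hopt w) (Nat.lt_succ_self i)).trans ?_
    rw [hlast.length_eq, Nat.multichoose_eq, mul_comm]
    congr 2
  · obtain ⟨F, hF⟩ := exists_isMostVital M w hℓm
    obtain ⟨F', hF', hex, A, hAF', hA⟩ := exists_isExhaustible_dominating hE (hne w) hF.1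
    refine ⟨F', (hmemc F').2 ((isRelevant_iff hE).2 ⟨hF', hex⟩), hF', fun G hG => ?_⟩
    exact (hF.2 G hG).trans
      (y_le_of_opt_eq hE hAF' hA (hopt w F hF.1.le) (hopt w F' hF'.le))
  · intro hu F hF
    exact (hmemc F).2 ((isRelevant_iff hE).2 ⟨hF.1, hF.isExhaustible hE hkpos (hopt w) hu⟩)
  · intro J hJ hlam hinj F hF
    obtain ⟨F', hF', hex, A, hAF', hA⟩ := exists_isExhaustible_dominating hE (hne w) hF
    refine ⟨F', (hmemc F').2 ((isRelevant_iff hE).2 ⟨hF', hex⟩), fun μ hμ => ?_⟩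
    refine y_le_of_opt_eq hE hAF' ?_ (hopt _ F hF.le) (hopt _ F' hF'.le)
    -- The equality of bases found at `lam` holds at every μ in J.
    rw [← opt_weight_eq hJ hinj hlam hμ]
    exact hA
  · have h1 := root_time_le (M := M) (w := w) (f := f (Fintype.card E)) (ℓ := i + 1) hE hes hmem
      (r := Nat.log 2 es.length + 1) (Nat.lt_pow_succ_log_self one_lt_two _).le
    have h2 := hroot.levels_time_le (f := f (Fintype.card E)) (H := H (Fintype.card E)) hE hkpos
      (hopt w) (n := i) (by omega)
    have h3 := LevelValid.output_time_le (H := H (Fintype.card E)) (hopt w) hlast.valid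
    have h4 := root_cost_le (hℓpos.trans_le hℓm) hℓpos (hf (Fintype.card E))
    have h5 := tree_cost_le (H (Fintype.card E)) i hkpos (hf (Fintype.card E))
    simp only [zero_add] at h2
    rw [hlast.length_eq] at h3
    rw [hlen] at h1
    have htime : out.time = 1 + ((root M w (f (Fintype.card E)) (i + 1) es).time +
      ((levels M w (f (Fintype.card E)) (H (Fintype.card E)) i
        [(root M w (f (Fintype.card E)) (i + 1) es).val]).time +
      (output M w (H (Fintype.card E)) (levels M w (f (Fintype.card E)) (H (Fintype.card E)) i
        [(root M w (f (Fintype.card E)) (i + 1) es).val]).val).time)) := rfl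
    have h6 : out.time ≤ ((Nat.log 2 (Fintype.card E) + 1) * (2 * Fintype.card E + 2) +
        (i + 1 + 1) * (Fintype.card E * (f (Fintype.card E) + 1) + 2) + 3 * Fintype.card E + 6) +
        28 * ((rk M + (i + 1)) ^ i *
          (H (Fintype.card E) + rk M * (i + 1) * f (Fintype.card E))) := by
      omega
    have h7 := Nat.cast_le (α := ℝ).2 h6
    rw [Nat.cast_add] at h7
    refine h7.trans ((add_le_add_left h4 _).trans (le_of_eq ?_))
    push_cast
    ring
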